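/- All graphs are finite and simple, with at least one vertex. For a graph $G$ and $\lambda\ge 0$ let $Z^{\mathrm{match}}_G(\lambda)=\sum_{M}\lambda^{|M|}$, summed over all matchings $M$ of $G$ (sets of pairwise disjoint edges, including $\emptyset$), and $Z^{\mathrm{ind}}_G(\lambda)=\sum_{I}\lambda^{|I|}$, summed over all independent sets $I$ of $G$ (including $\emptyset$). For $r\ge 1$ let $\rho_r(G)$ be the distribution of the isomorphism class of the rooted graph obtained by choosing a vertex $v$ of $G$ uniformly at random and taking the subgraph of $G$ induced by the vertices at distance at most $r$ from $v$, rooted at $v$. The sampling distance of two graphs $G,G'$ is $$\delta_\circ(G,G')=\sum_{r=1}^\infty 2^{-r}\,\|\rho_r(G)-\rho_r(G')\|_{TV},\qquad \|p-q\|_{TV}=\tfrac12\sum_a|p(a)-q(a)|.$$ Theorem. For every integer $d\ge 2$ there exist continuous, strictly increasing functions $\lambda\mapsto s^{\mathrm{match}}(d,\lambda)$ and $\lambda\mapsto s^{\mathrm{ind}}(d,\lambda)$ on $[0,\infty)$ with $s^{\mathrm{match}}(d,0)=s^{\mathrm{ind}}(d,0)=0$ such that for every $d$-regular graph $G$ and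 every $\lambda\ge 0$, $$\frac{1}{|V(G)|}\log Z^{\mathrm{match}}_G(\lambda)\le \frac{1}{2d}\log Z^{\mathrm{match}}_{K_{d,d}}(\lambda)-s^{\mathrm{match}}(d,\lambda)\,\delta_\circ(G,K_{d,d}),$$ $$\frac{1}{|V(G)|}\log Z^{\mathrm{ind}}_G(\lambda)\le \frac{1}{2d}\log Z^{\mathrm{ind}}_{K_{d,d}}(\lambda)-s^{\mathrm{ind}}(d,\lambda)\,\delta_\circ(G,K_{d,d}).$$ -/

import Mathlib

namespace RegularStability

noncomputable section

open Classical Finset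

/-- A matching of `G`, viewed as a set of edges: no two distinct members share an end vertex. -/
def IsMatchingSet {V : Type*} (G : SimpleGraph V) (M : Finset (Sym2 V)) : Prop :=
  (∀ e ∈ M, e ∈ G.edgeSet) ∧ ∀ e ∈ M, ∀ f ∈ M, ∀ v, v ∈ e → v ∈ f → e = f

/-- The matching polynomial: the sum of `lam ^ |M|` over all matchings `M` of `G`. -/
def Zmatch {V : Type*} [Fintype V] (G : SimpleGraph V) (lam : ℝ) : ℝ :=
  ∑ M ∈ (univ : Finset (Finset (Sym2 V))).filter
      (fun M : Finset (Sym2 V) => IsMatchingSet G M), lam ^ #M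

/-- The independence polynomial: the sum of `lam ^ |I|` over all independent sets `I` of `G`. -/
def Zind {V : Type*} [Fintype V] (G : SimpleGraph V) (lam : ℝ) : ℝ :=
  ∑ I ∈ (univ : Finset (Finset V)).filter (fun I : Finset V => G.IsIndepSet (I : Set V)), lam ^ #I

/-- A finite rooted graph on a vertex set `{0, …, n - 1}`. -/
structure RootedGraph where
  n : ℕ
  graph : SimpleGraph (Fin n)
  root : Fin n

/-- Root-preserving graph isomorphism. -/
instance rootedGraphSetoid : Setoid RootedGraph where
  r A B := ∃ φ : A.graph ≃g B.graph, φ A.root = B.root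
  iseqv :=
    { refl := fun _ => ⟨SimpleGraph.Iso.refl, rfl⟩
      symm := by
        rintro A B ⟨φ, h⟩
        exact ⟨φ.symm, by rw [← h]; exact φ.symm_apply_apply _⟩
      trans := by
        rintro A B C ⟨φ, h⟩ ⟨ψ, h'⟩
        exact ⟨φ.trans ψ, by rw [← h', ← h]; rfl⟩ }

/-- Isomorphism classes of finite rooted graphs. -/
abbrev RootedClass : Type := Quotient rootedGraphSetoid

/-- The vertices at distance at most `r` from `v`. -/
def closedBall {V : Type*} (G : SimpleGraph V) (v : V) (r : ℕ) : Set V :=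
  {w | G.edist v w ≤ (r : ℕ∞)}

/-- The depth `r` ball around `v`, as an induced subgraph rooted at `v`; it is copied to an initial
segment of `ℕ` by an arbitrary enumeration of its vertices. -/
def ballGraph {V : Type*} [Fintype V] (G : SimpleGraph V) (v : V) (r : ℕ) : RootedGraph where
  n := Fintype.card (closedBall G v r)
  graph := (G.induce (closedBall G v r)).map (Fintype.equivFin (closedBall G v r)).toEmbedding
  root := Fintype.equivFin (closedBall G v r) ⟨v, by simp [closedBall]⟩

/-- The isomorphism class of the depth `r` ball around `v`. -/
def ballClass {V : Type*} [Fintype V] (G : SimpleGraph V) (r : ℕ) (v : V) : RootedClass :=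
  Quotient.mk rootedGraphSetoid (ballGraph G v r)

/-- The mass function of `ρ_r(G)`: the probability that the depth `r` ball around a uniformly
random vertex of `G` has the isomorphism class `c`. -/
def rho {V : Type*} [Fintype V] (G : SimpleGraph V) (r : ℕ) (c : RootedClass) : ℝ :=
  (#{v : V | ballClass G r v = c} : ℝ) / (Fintype.card V : ℝ)

/-- Total variation distance of two mass functions. -/
def tvDist {α : Type*} (p q : α → ℝ) : ℝ := (1 / 2) * ∑' a, |p a - q a|

/-- The sampling distance: the sum over `r ≥ 1` of `2 ^ (-r)` times the total variation distance
of `ρ_r(G)` and `ρ_r(H)`. -/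
def samplingDist {V W : Type*} [Fintype V] [Fintype W]
    (G : SimpleGraph V) (H : SimpleGraph W) : ℝ :=
  ∑' k : ℕ, (1 / 2 : ℝ) ^ (k + 1) * tvDist (rho G (k + 1)) (rho H (k + 1))

end

end RegularStability

namespace RegularStability

noncomputable section

open Classical Finset

/-! Both inequalities are integrated forms of a bound on the logarithmic derivative. With n the
number of vertices of G and K = K_{d,d}, it suffices to find a continuous rate c, positive for lam >
0, with Z_G'/(n Z_G) + c(lam) · (fraction of bad vertices) ≤ Z_K'/(2d Z_K); then s is the primitive
of c vanishing at 0 (`log_partFun_le_of_deriv`). A vertex is bad if its component is not K_{d,d}.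
Balls around good vertices look exactly like balls in K_{d,d}, so the bad fraction bounds the
sampling distance (`samplingDist_le`). What remains is, in each model, a sharp occupancy bound with
a remainder that every bad vertex makes positive.

Independent sets. Fix v and condition on I outside N(v). The possible traces of I on N(v) form a
simplicial complex. By local LYM and Chebyshev's inequality, the mean size of a random nonempty face
is largest for the full simplex (`complex_ineq`, `downset_ineq`). Summing over v expresses both
sides through Z and Z', and gives the occupancy of K_{d,d} as the bound (`indFam_occupancy`). The
remainder is the Chebyshev term for sizes 1 and d; it is positive when the complex has a vertex but
is not full.

Matchings. Let Y_u be the number of uncovered neighbours of an uncovered vertex u. The mean of Y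
over all uncovered vertices determines Z'/Z, so it has to be compared with its value mu in K_{d,d}.
Removing and adding matching edges gives an identity for every test function B (`stein_identity`).
Its error term, the energy, compares Y at adjacent uncovered vertices and counts uncovered
triangles. Choosing B to solve the Stein equation turns the identity into mu · #uncovered − sum of Y
= lam · energy in expectation (`match_balance`). This B is strictly decreasing below d
(`SteinEq.lt`), hence the energy is nonnegative, and positive at a defect. Solvability of the Stein
equation comes from K_{d,d} itself, where the energy vanishes.

In both models a bad vertex sees a defect with probability bounded below, because any admissible
local pattern can be forced inside a window of bounded size (`pow_mul_partFun_le_window`). -/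

/-! ### Partition functions of set families -/

/-- The generating function of a family of finite sets. -/
def partFun {α : Type*} (F : Finset (Finset α)) (lam : ℝ) : ℝ := ∑ I ∈ F, lam ^ #I

/-- The derivative of `partFun`. -/
def partDeriv {α : Type*} (F : Finset (Finset α)) (lam : ℝ) : ℝ := ∑ I ∈ F, (#I : ℝ) * lam ^ (#I - 1)

section PartFun

variable {α : Type*} {F : Finset (Finset α)} {lam : ℝ}

theorem hasDerivAt_partFun (F : Finset (Finset α)) (lam : ℝ) :
    HasDerivAt (partFun F) (partDeriv F lam) lam := by
  unfold partFun partDeriv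
  exact HasDerivAt.fun_sum fun I _ => hasDerivAt_pow _ _

theorem continuous_partFun (F : Finset (Finset α)) : Continuous (partFun F) := by
  unfold partFun; fun_prop

theorem continuous_partDeriv (F : Finset (Finset α)) : Continuous (partDeriv F) := by
  unfold partDeriv; fun_prop

theorem partFun_zero (hF : ∅ ∈ F) : partFun F 0 = 1 := by
  unfold partFun
  rw [sum_eq_single_of_mem ∅ hF]
  · simp
  · intro I _ hI
    simp [hI]

theorem one_le_partFun (hF : ∅ ∈ F) (hl : 0 ≤ lam) : 1 ≤ partFun F lam := by
  have h := single_le_sum (f := fun I : Finset α => lam ^ #I) (fun I _ => by positivity) hF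
  simpa [partFun] using h

theorem partFun_pos (hF : ∅ ∈ F) (hl : 0 ≤ lam) : 0 < partFun F lam :=
  lt_of_lt_of_le one_pos (one_le_partFun hF hl)

theorem mul_partDeriv (F : Finset (Finset α)) (lam : ℝ) :
    lam * partDeriv F lam = ∑ I ∈ F, (#I : ℝ) * lam ^ #I := by
  unfold partDeriv
  rw [mul_sum]
  refine sum_congr rfl fun I _ => ?_
  rcases Nat.eq_zero_or_pos #I with h | h
  · simp [h]
  · conv_rhs => rw [← Nat.sub_add_cancel h, pow_succ]
    rw [Nat.sub_add_cancel h]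
    ring

theorem partDeriv_nonneg (F : Finset (Finset α)) (hl : 0 ≤ lam) : 0 ≤ partDeriv F lam :=
  sum_nonneg fun _ _ => by positivity

/-- A prescribed pattern `T` in a window `W` occurs with probability bounded below in terms of the
size of the window. -/
theorem pow_mul_partFun_le_window [DecidableEq α] {W T : Finset α} (hT : T ⊆ W)
    (h : ∀ I ∈ F, (I \ W) ∪ T ∈ F) (hl : 0 ≤ lam) :
    lam ^ #T * partFun F lam ≤ (1 + lam) ^ #W * ∑ I ∈ F with I ∩ W = T, lam ^ #I := by
  have hW : (1 + lam) ^ #W = ∑ S ∈ W.powerset, lam ^ #S := by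
    have := sum_pow_mul_eq_add_pow lam 1 W
    simp only [one_pow, mul_one] at this
    rw [this, add_comm]
  have hdisj : ∀ I : Finset α, Disjoint (I \ W) T := fun I =>
    disjoint_of_subset_right hT sdiff_disjoint
  -- Record the trace on `W`, then overwrite it by `T`. This is injective, and the two components
  -- together carry the weight of `I` times `lam ^ #T`; the free first component costs the factor
  -- `(1 + lam) ^ #W`.
  let φ : Finset α → Finset α × Finset α := fun I => (I ∩ W, (I \ W) ∪ T)
  have hinj : Set.InjOn φ (F : Set (Finset α)) := by
    intro I _ J _ hIJ
    simp only [φ, Prod.mk.injEq] at hIJ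
    obtain ⟨h1, h2⟩ := hIJ
    have h3 : I \ W = J \ W := by
      have := congrArg (· \ T) h2
      simpa [union_sdiff_right, sdiff_eq_self_of_disjoint (hdisj I),
        sdiff_eq_self_of_disjoint (hdisj J)] using this
    rw [← sdiff_union_inter I W, ← sdiff_union_inter J W, h1, h3]
  rw [hW, sum_mul_sum, ← sum_product', partFun, mul_sum]
  calc ∑ I ∈ F, lam ^ #T * lam ^ #I
      = ∑ I ∈ F, lam ^ #(φ I).1 * lam ^ #(φ I).2 := by
        refine sum_congr rfl fun I _ => ?_
        simp only [φ]
        rw [card_union_of_disjoint (hdisj I), ← pow_add, ← pow_add]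
        congr 1
        have := card_sdiff_add_card_inter I W
        omega
    _ = ∑ p ∈ F.image φ, lam ^ #p.1 * lam ^ #p.2 :=
        (sum_image (f := fun p : Finset α × Finset α => lam ^ #p.1 * lam ^ #p.2) hinj).symm
    _ ≤ _ := by
        refine sum_le_sum_of_subset_of_nonneg ?_ fun _ _ _ => by positivity
        intro p hp
        obtain ⟨I, hI, rfl⟩ := mem_image.1 hp
        simp only [φ, mem_product, mem_powerset, mem_filter]
        refine ⟨inter_subset_right, h I hI, ?_⟩
        rw [union_inter_distrib_right, sdiff_inter_self, empty_union, inter_eq_left.2 hT]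

end PartFun

/-! ### Integration of the occupancy bounds -/

theorem exists_strictMonoOn_primitive {c : ℝ → ℝ} (hc : ContinuousOn c (Set.Ici 0))
    (hpos : ∀ x, 0 < x → 0 < c x) :
    ∃ s : ℝ → ℝ, ContinuousOn s (Set.Ici 0) ∧ s 0 = 0 ∧ StrictMonoOn s (Set.Ici 0) ∧
      ∀ x, 0 < x → HasDerivAt s (c x) x := by
  -- Freezing `c` at its value at 0 on the negative axis makes the integrand continuous everywhere,
  -- so no one-sided derivatives are needed at 0.
  have hc' : Continuous fun x : ℝ => c (max x 0) :=
    hc.comp_continuous (by fun_prop) fun x => Set.mem_Ici.2 (le_max_right _ _)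
  have hd : ∀ x, HasDerivAt (fun x : ℝ => ∫ t in (0 : ℝ)..x, c (max t 0)) (c (max x 0)) x :=
    fun x => intervalIntegral.integral_hasDerivAt_right (hc'.intervalIntegrable _ _)
      (hc'.stronglyMeasurableAtFilter _ _) hc'.continuousAt
  have hcont : Continuous fun x : ℝ => ∫ t in (0 : ℝ)..x, c (max t 0) :=
    continuous_iff_continuousAt.2 fun x => (hd x).continuousAt
  refine ⟨_, hcont.continuousOn, by simp, ?_, fun x hx => ?_⟩
  · refine strictMonoOn_of_deriv_pos (convex_Ici 0) hcont.continuousOn fun x hx => ?_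
    rw [interior_Ici, Set.mem_Ioi] at hx
    rw [(hd x).deriv, max_eq_left hx.le]
    exact hpos x hx
  · simpa [max_eq_left hx.le] using hd x

/-- A comparison of logarithmic derivatives integrates to a comparison of free energies. -/
theorem log_partFun_le_of_deriv {α β : Type*} {F : Finset (Finset α)} {K : Finset (Finset β)}
    (hF : ∅ ∈ F) (hK : ∅ ∈ K) {n m eps : ℝ} {s c : ℝ → ℝ}
    (hs : ContinuousOn s (Set.Ici 0)) (hs0 : s 0 = 0) (hsd : ∀ x, 0 < x → HasDerivAt s (c x) x)
    (h : ∀ x, 0 < x → 1 / n * (partDeriv F x / partFun F x) + c x * eps ≤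
      1 / m * (partDeriv K x / partFun K x)) {x : ℝ} (hx : 0 ≤ x) :
    1 / n * Real.log (partFun F x) ≤ 1 / m * Real.log (partFun K x) - s x * eps := by
  let Φ : ℝ → ℝ := fun x =>
    1 / m * Real.log (partFun K x) - s x * eps - 1 / n * Real.log (partFun F x)
  have hcont : ContinuousOn Φ (Set.Ici 0) := by
    have h1 : ContinuousOn (fun x => Real.log (partFun K x)) (Set.Ici 0) :=
      (continuous_partFun K).continuousOn.log fun x hx => (partFun_pos hK hx).ne'
    have h2 : ContinuousOn (fun x => Real.log (partFun F x)) (Set.Ici 0) :=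
      (continuous_partFun F).continuousOn.log fun x hx => (partFun_pos hF hx).ne'
    exact ((continuousOn_const.mul h1).sub (hs.mul continuousOn_const)).sub
      (continuousOn_const.mul h2)
  have hd : ∀ x, 0 < x → HasDerivAt Φ (1 / m * (partDeriv K x / partFun K x) - c x * eps -
      1 / n * (partDeriv F x / partFun F x)) x := fun x hx =>
    ((((hasDerivAt_partFun K x).log (partFun_pos hK hx.le).ne').const_mul _).sub
      ((hsd x hx).mul_const _)).sub
      (((hasDerivAt_partFun F x).log (partFun_pos hF hx.le).ne').const_mul _)
  have hmono : MonotoneOn Φ (Set.Ici 0) := by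
    refine monotoneOn_of_deriv_nonneg (convex_Ici 0) hcont ?_ ?_
    · intro y hy
      rw [interior_Ici] at hy
      exact (hd y hy).differentiableAt.differentiableWithinAt
    · intro y hy
      rw [interior_Ici] at hy
      rw [(hd y hy).deriv]
      linarith [h y hy]
  have h0 : Φ 0 = 0 := by simp [Φ, partFun_zero hF, partFun_zero hK, hs0]
  have := hmono (Set.self_mem_Ici) hx hx
  rw [h0] at this
  simp only [Φ] at this
  linarith

/-! ### Vertices in complete bipartite components -/

section Structure

variable {V : Type*} [Fintype V]

/-- The neighbourhood of a vertex, as a finite set. -/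
def nbr (G : SimpleGraph V) (v : V) : Finset V := {w | G.Adj v w}

@[simp] theorem mem_nbr {G : SimpleGraph V} {v w : V} : w ∈ nbr G v ↔ G.Adj v w := by simp [nbr]

/-- In a regular graph these are the vertices whose component is complete bipartite. -/
def IsGood (G : SimpleGraph V) (v : V) : Prop :=
  (∀ u w, G.Adj v u → G.Adj v w → ¬ G.Adj u w) ∧
    ∀ u x, G.Adj v u → G.Adj u x → ∀ y, G.Adj v y → G.Adj x y

/-- The vertices outside complete bipartite components. -/
def bad (G : SimpleGraph V) : Finset V := {v | ¬ IsGood G v}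

theorem nbr_eq_of_subset {G : SimpleGraph V} {d : ℕ} (hG : ∀ v, #(nbr G v) = d) {x y : V}
    (h : nbr G x ⊆ nbr G y) : nbr G x = nbr G y :=
  eq_of_subset_of_card_le h (by rw [hG, hG])

/-- For a neighbour `u` of `v`, equal degrees upgrade inclusions of neighbourhoods to equalities:
all of N(u) has neighbourhood N(v), and all of N(v) has neighbourhood N(u). So N(v) and N(u) are the
sides of a K_{d,d} that no edge leaves. -/
theorem IsGood.exists_embedding {G : SimpleGraph V} {d : ℕ} (hG : ∀ v, #(nbr G v) = d)
    (hd : 0 < d) {v : V} (hv : IsGood G v) :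
    ∃ φ : completeBipartiteGraph (Fin d) (Fin d) ↪g G, φ (Sum.inr ⟨0, hd⟩) = v ∧
      ∀ a y, G.Adj (φ a) y → y ∈ Set.range φ := by
  obtain ⟨h1, h2⟩ := hv
  obtain ⟨u, hu⟩ : (nbr G v).Nonempty := card_pos.1 (by rw [hG]; exact hd)
  rw [mem_nbr] at hu
  have hN : ∀ x, G.Adj u x → nbr G v = nbr G x := fun x hx =>
    nbr_eq_of_subset hG fun y hy => by simpa using h2 u x hu hx y (by simpa using hy)
  have hN' : ∀ x, G.Adj v x → nbr G u = nbr G x := fun x hx =>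
    nbr_eq_of_subset hG fun y hy => by
      have : x ∈ nbr G y := by rw [← hN y (by simpa using hy)]; simpa using hx
      simpa using (mem_nbr.1 this).symm
  let e : Fin d ≃ nbr G v := ((nbr G v).equivFinOfCardEq (hG v)).symm
  let f' : Fin d ≃ nbr G u := ((nbr G u).equivFinOfCardEq (hG u)).symm
  -- The swap places `v` at index 0 of its side, so that the image of the root is known.
  let f : Fin d ≃ nbr G u :=
    (Equiv.swap ⟨0, hd⟩ (f'.symm ⟨v, by simpa using hu.symm⟩)).trans f'
  have hf0 : (f ⟨0, hd⟩ : V) = v := by simp [f]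
  have he : ∀ i, G.Adj v (e i) := fun i => mem_nbr.1 (e i).2
  have hf : ∀ i, G.Adj u (f i) := fun i => mem_nbr.1 (f i).2
  have hvu : ∀ x, G.Adj v x → ¬ G.Adj u x := fun x hx => h1 u x hu hx
  have hef : ∀ i j, G.Adj (e i) (f j) := fun i j => by
    have : (e i : V) ∈ nbr G (f j) := by rw [← hN _ (hf j)]; exact (e i).2
    exact (mem_nbr.1 this).symm
  have hff : ∀ i j, ¬ G.Adj (f i) (f j) := fun i j h => by
    have : (f j : V) ∈ nbr G v := by rw [hN _ (hf i)]; simpa using h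
    exact hvu _ (mem_nbr.1 this) (hf j)
  let g : Fin d ⊕ Fin d → V := Sum.elim (fun i => e i) (fun j => f j)
  have hginj : Function.Injective g := by
    rintro (i | i) (j | j) hij
    · exact congrArg Sum.inl (e.injective (Subtype.ext hij))
    · exact absurd (show G.Adj u (e i) by
        have : (e i : V) = f j := hij
        rw [this]; exact hf j) (hvu _ (he i))
    · exact absurd (show G.Adj u (e j) by
        have : (f i : V) = e j := hij
        rw [← this]; exact hf i) (hvu _ (he j))
    · exact congrArg Sum.inr (f.injective (Subtype.ext hij))
  refine ⟨⟨⟨g, hginj⟩, ?_⟩, hf0, ?_⟩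
  · rintro (i | i) (j | j)
    · simpa [g] using h1 _ _ (he i) (he j)
    · simpa [g] using hef i j
    · simpa [g] using (hef j i).symm
    · simpa [g] using hff i j
  · rintro (i | i) y hy
    · have hy' : y ∈ nbr G u := by rw [hN' _ (he i)]; simpa [g] using hy
      exact ⟨Sum.inr (f.symm ⟨y, hy'⟩), by simp [g]⟩
    · have hy' : y ∈ nbr G v := by rw [hN _ (hf i)]; simpa [g] using hy
      exact ⟨Sum.inl (e.symm ⟨y, hy'⟩), by simp [g]⟩

theorem exists_walk_of_closed_embedding {V W : Type*} {H : SimpleGraph W} {G : SimpleGraph V}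
    (φ : H ↪g G) (hφ : ∀ a y, G.Adj (φ a) y → y ∈ Set.range φ) {x y : V} (p : G.Walk x y) :
    ∀ a, φ a = x → ∃ b, φ b = y ∧ ∃ q : H.Walk a b, q.length = p.length := by
  induction p with
  | nil => exact fun a ha => ⟨a, ha, .nil, rfl⟩
  | cons h p ih =>
    rintro a rfl
    obtain ⟨a', rfl⟩ := hφ a _ h
    obtain ⟨b, hb, q, hq⟩ := ih a' rfl
    exact ⟨b, hb, .cons (φ.map_adj_iff.1 h) q, by simp [hq]⟩

theorem edist_le_iff_exists_walk {V : Type*} {G : SimpleGraph V} {x y : V} {r : ℕ} :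
    G.edist x y ≤ r ↔ ∃ p : G.Walk x y, p.length ≤ r := by
  constructor
  · intro h
    obtain ⟨p, hp⟩ := SimpleGraph.exists_walk_of_edist_ne_top
      (ne_top_of_le_ne_top (ENat.natCast_ne_top r) h)
    exact ⟨p, by rw [← hp] at h; exact_mod_cast h⟩
  · rintro ⟨p, hp⟩
    exact (SimpleGraph.edist_le p).trans (by exact_mod_cast hp)

theorem mem_closedBall_of_closed_embedding {V W : Type*} {H : SimpleGraph W} {G : SimpleGraph V}
    (φ : H ↪g G) (hφ : ∀ a y, G.Adj (φ a) y → y ∈ Set.range φ) (a : W) (r : ℕ) (y : V) :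
    y ∈ closedBall G (φ a) r ↔ ∃ b ∈ closedBall H a r, φ b = y := by
  simp only [closedBall, Set.mem_ofPred_eq, edist_le_iff_exists_walk]
  constructor
  · rintro ⟨p, hp⟩
    obtain ⟨b, hb, q, hq⟩ := exists_walk_of_closed_embedding φ hφ p a rfl
    exact ⟨b, ⟨q, hq ▸ hp⟩, hb⟩
  · rintro ⟨b, ⟨q, hq⟩, rfl⟩
    exact ⟨q.map φ.toHom, by simpa using hq⟩

/-- Walks starting in the image never leave it and lift with the same length, so the embedding
restricts to a bijection of balls. -/
theorem ballClass_eq_of_closed_embedding {W : Type*} [Fintype W] {H : SimpleGraph W}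
    {G : SimpleGraph V} (φ : H ↪g G) (hφ : ∀ a y, G.Adj (φ a) y → y ∈ Set.range φ) (a : W)
    (r : ℕ) : ballClass G r (φ a) = ballClass H r a := by
  refine (Quotient.sound ?_ : ballClass H r a = ballClass G r (φ a)).symm
  have hmem := mem_closedBall_of_closed_embedding φ hφ a r
  let g : closedBall H a r → closedBall G (φ a) r := fun b => ⟨φ b, (hmem _).2 ⟨b, b.2, rfl⟩⟩
  have hg : Function.Bijective g := by
    constructor
    · intro b c hbc
      exact Subtype.ext (φ.injective (congrArg Subtype.val hbc))
    · rintro ⟨y, hy⟩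
      obtain ⟨b, hb, rfl⟩ := (hmem y).1 hy
      exact ⟨⟨b, hb⟩, rfl⟩
  let ψ : H.induce (closedBall H a r) ≃g G.induce (closedBall G (φ a) r) :=
    ⟨Equiv.ofBijective g hg, by intro b c; simp [g]⟩
  refine ⟨((SimpleGraph.Iso.map (Fintype.equivFin (closedBall H a r)) _).symm.trans ψ).trans
    (SimpleGraph.Iso.map (Fintype.equivFin (closedBall G (φ a) r)) _), ?_⟩
  change Fintype.equivFin _ (ψ ((Fintype.equivFin (closedBall H a r)).symm
    (Fintype.equivFin (closedBall H a r) _))) = _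
  rw [Equiv.symm_apply_apply]
  rfl

end Structure

/-! ### The sampling distance from a complete bipartite graph -/

section Sampling

variable {V : Type*} [Fintype V]

theorem card_nbr_completeBipartiteGraph (d : ℕ) (v : Fin d ⊕ Fin d) :
    #(nbr (completeBipartiteGraph (Fin d) (Fin d)) v) = d := by
  rcases v with i | i
  · have : nbr (completeBipartiteGraph (Fin d) (Fin d)) (Sum.inl i) =
        univ.map Function.Embedding.inr := by
      ext x; rcases x with x | x <;> simp
    simp [this]
  · have : nbr (completeBipartiteGraph (Fin d) (Fin d)) (Sum.inr i) =
        univ.map Function.Embedding.inl := by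
      ext x; rcases x with x | x <;> simp
    simp [this]

theorem isGood_completeBipartiteGraph (d : ℕ) (v : Fin d ⊕ Fin d) :
    IsGood (completeBipartiteGraph (Fin d) (Fin d)) v := by
  constructor
  · rintro (u | u) (w | w) <;> rcases v with v | v <;> simp
  · rintro (u | u) (x | x) <;> rcases v with v | v <;> simp

theorem exists_ballClass_eq {d : ℕ} (hd : 0 < d) (r : ℕ) : ∃ c : RootedClass,
    (∀ w, ballClass (completeBipartiteGraph (Fin d) (Fin d)) r w = c) ∧
    ∀ (V : Type*) [Fintype V] (G : SimpleGraph V), (∀ v, #(nbr G v) = d) →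
      ∀ v, IsGood G v → ballClass G r v = c := by
  refine ⟨ballClass (completeBipartiteGraph (Fin d) (Fin d)) r (Sum.inr ⟨0, hd⟩), ?_, ?_⟩
  · intro w
    -- Applying the embedding of K_{d,d} to K_{d,d} itself replaces an appeal to vertex
    -- transitivity.
    obtain ⟨φ, h0, hφ⟩ := (isGood_completeBipartiteGraph d w).exists_embedding
      (card_nbr_completeBipartiteGraph d) hd
    conv_lhs => rw [← h0]
    exact ballClass_eq_of_closed_embedding φ hφ _ r
  · intro V _ G hG v hv
    obtain ⟨φ, h0, hφ⟩ := hv.exists_embedding hG hd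
    conv_lhs => rw [← h0]
    exact ballClass_eq_of_closed_embedding φ hφ _ r

/-- The distribution for K_{d,d} is a point mass at one class `c`, so the distance is the
probability that a ball of `G` is not of class `c`; this can only happen at bad vertices. -/
theorem tvDist_rho_le {d : ℕ} (hd : 0 < d) [Nonempty V] {G : SimpleGraph V}
    (hG : ∀ v, #(nbr G v) = d) (r : ℕ) :
    tvDist (rho G r) (rho (completeBipartiteGraph (Fin d) (Fin d)) r) ≤
      #(bad G) / (Fintype.card V : ℝ) := by
  obtain ⟨c, hK, hc⟩ := exists_ballClass_eq hd r
  have hn : (0 : ℝ) < Fintype.card V := by exact_mod_cast Fintype.card_pos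
  have hKrho : ∀ a, rho (completeBipartiteGraph (Fin d) (Fin d)) r a = if a = c then 1 else 0 := by
    intro a
    have hd' : (d : ℝ) + d ≠ 0 := by positivity
    by_cases h : a = c
    · simp [rho, hK, h, hd']
    · simp [rho, hK, h, Ne.symm h]
  set S : Finset RootedClass := insert c (univ.image (ballClass G r)) with hS
  have hsum : ∑ a ∈ S, rho G r a = 1 := by
    unfold rho
    rw [← sum_div, ← Nat.cast_sum, ← card_eq_sum_card_fiberwise (f := ballClass G r)]
    · simp [hn.ne']
    · intro v _; simp [hS]
  have hnn : ∀ a, 0 ≤ rho G r a := fun a => by unfold rho; positivity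
  have hle : rho G r c ≤ 1 := by
    rw [← hsum]; exact single_le_sum (fun a _ => hnn a) (by simp [hS])
  have htv : tvDist (rho G r) (rho (completeBipartiteGraph (Fin d) (Fin d)) r) = 1 - rho G r c := by
    unfold tvDist
    rw [tsum_eq_sum (s := S)]
    · have hcS : c ∈ S := by simp [hS]
      rw [← add_sum_erase _ _ hcS] at hsum ⊢
      have : ∑ a ∈ S.erase c, |rho G r a - rho (completeBipartiteGraph (Fin d) (Fin d)) r a| =
          ∑ a ∈ S.erase c, rho G r a := by
        refine sum_congr rfl fun a ha => ?_
        rw [hKrho, if_neg (ne_of_mem_erase ha), sub_zero, abs_of_nonneg (hnn a)]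
      rw [this, hKrho, if_pos rfl, abs_of_nonpos (by linarith)]
      linarith
    · intro a ha
      simp only [hS, mem_insert, mem_image, mem_univ, true_and, not_or, not_exists] at ha
      rw [hKrho, if_neg ha.1]
      simp [rho, ha.2]
  rw [htv, rho, one_sub_div hn.ne']
  gcongr
  have h1 : #{v : V | IsGood G v} ≤ #{v : V | ballClass G r v = c} :=
    card_le_card fun v hv => by simpa using hc V G hG v (by simpa using hv)
  have h2 : #{v : V | IsGood G v} + #(bad G) = #(univ : Finset V) := by
    rw [bad]
    convert card_filter_add_card_filter_not (s := (univ : Finset V)) (IsGood G)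
  have h3 : Fintype.card V ≤ #(bad G) + #{v : V | ballClass G r v = c} := by
    rw [← card_univ]; omega
  have h4 : (Fintype.card V : ℝ) ≤ #(bad G) + #{v : V | ballClass G r v = c} := by
    exact_mod_cast h3
  linarith

theorem samplingDist_le {d : ℕ} (hd : 0 < d) [Nonempty V] {G : SimpleGraph V}
    (hG : ∀ v, #(nbr G v) = d) :
    samplingDist G (completeBipartiteGraph (Fin d) (Fin d)) ≤
      #(bad G) / (Fintype.card V : ℝ) := by
  have hgeo : HasSum (fun k : ℕ => (1 / 2 : ℝ) ^ (k + 1)) 1 := by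
    have := hasSum_geometric_two.mul_left (1 / 2 : ℝ)
    simpa [pow_succ'] using this
  have htv0 : ∀ k, 0 ≤ tvDist (rho G k) (rho (completeBipartiteGraph (Fin d) (Fin d)) k) :=
    fun k => mul_nonneg (by norm_num) (tsum_nonneg fun _ => abs_nonneg _)
  have hb := hgeo.mul_right (#(bad G) / (Fintype.card V : ℝ))
  have hle : ∀ k : ℕ, (1 / 2 : ℝ) ^ (k + 1) *
      tvDist (rho G (k + 1)) (rho (completeBipartiteGraph (Fin d) (Fin d)) (k + 1)) ≤
      (1 / 2 : ℝ) ^ (k + 1) * (#(bad G) / (Fintype.card V : ℝ)) := fun k => by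
    gcongr; exact tvDist_rho_le hd hG _
  have hsum := Summable.of_nonneg_of_le (fun k => mul_nonneg (by positivity) (htv0 (k + 1))) hle
    hb.summable
  have := hsum.tsum_le_tsum hle hb.summable
  rwa [hb.tsum_eq, one_mul] at this

end Sampling

/-! ### A correlation inequality for simplicial complexes -/

/-- Chebyshev's sum inequality for the identity and an antitone sequence, with the contribution of
one pair of indices as a remainder. -/
theorem chebyshev_with_remainder {s : Finset ℕ} {a b : ℕ → ℝ} (ha : AntitoneOn a s)
    (hb : ∀ k ∈ s, 0 ≤ b k) {p q : ℕ} (hp : p ∈ s) (hq : q ∈ s) (hpq : p ≠ q) :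
    ((q : ℝ) - p) * (a p - a q) * (b p * b q) ≤
      (∑ j ∈ s, (j : ℝ) * b j) * (∑ k ∈ s, a k * b k) -
        (∑ j ∈ s, b j) * ∑ k ∈ s, (k : ℝ) * (a k * b k) := by
  let T : ℕ × ℕ → ℝ := fun x => ((x.2 : ℝ) - x.1) * (a x.1 - a x.2) * (b x.1 * b x.2)
  have hT : ∀ x ∈ s ×ˢ s, 0 ≤ T x := by
    rintro ⟨j, k⟩ hx
    obtain ⟨hj, hk⟩ := mem_product.1 hx
    refine mul_nonneg ?_ (mul_nonneg (hb _ hj) (hb _ hk))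
    rcases le_total j k with h | h
    · exact mul_nonneg (sub_nonneg.2 (by exact_mod_cast h)) (sub_nonneg.2 (ha hj hk h))
    · exact mul_nonneg_of_nonpos_of_nonpos (sub_nonpos.2 (by exact_mod_cast h))
        (sub_nonpos.2 (ha hk hj h))
  -- All terms of the double sum are nonnegative; the two orderings of the chosen pair contribute
  -- equally, which cancels the factor 2 of the symmetrisation.
  have hpair : T (p, q) + T (q, p) ≤ ∑ x ∈ s ×ˢ s, T x := by
    rw [← sum_pair (f := T) (by simp [hpq] : (p, q) ≠ (q, p))]
    refine sum_le_sum_of_subset_of_nonneg ?_ fun x hx _ => hT x hx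
    intro x hx
    simp only [mem_insert, mem_singleton] at hx
    rcases hx with rfl | rfl <;> simp [hp, hq]
  have hsum : ∑ x ∈ s ×ˢ s, T x = 2 * ((∑ j ∈ s, (j : ℝ) * b j) * (∑ k ∈ s, a k * b k) -
        (∑ j ∈ s, b j) * ∑ k ∈ s, (k : ℝ) * (a k * b k)) := by
    have hprod : ∀ f g : ℕ → ℝ, ∑ x ∈ s ×ˢ s, f x.1 * g x.2 = (∑ j ∈ s, f j) * ∑ k ∈ s, g k :=
      fun f g => by rw [sum_mul_sum, ← sum_product']
    have e1 : ∀ x : ℕ × ℕ, T x = (a x.1 * b x.1) * ((x.2 : ℝ) * b x.2)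
        - ((x.1 : ℝ) * (a x.1 * b x.1)) * b x.2 - b x.1 * ((x.2 : ℝ) * (a x.2 * b x.2))
        + ((x.1 : ℝ) * b x.1) * (a x.2 * b x.2) := fun x => by simp only [T]; ring
    simp only [e1, sum_add_distrib, sum_sub_distrib]
    rw [hprod (fun j => a j * b j) (fun k => (k : ℝ) * b k),
      hprod (fun j => (j : ℝ) * (a j * b j)) b, hprod b (fun k => (k : ℝ) * (a k * b k)),
      hprod (fun j => (j : ℝ) * b j) (fun k => a k * b k)]
    ring
  have : T (p, q) + T (q, p) = 2 * (((q : ℝ) - p) * (a p - a q) * (b p * b q)) := by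
    simp only [T]; ring
  linarith

section Complex

variable {α : Type*}

/-- The number of members of `S` of size `k`. -/
def level (S : Finset (Finset α)) (k : ℕ) : ℕ := #{s ∈ S | #s = k}

/-- Double counting of inclusions: a face of size k + 1 contains k + 1 faces of size k, and a face
of size k extends by at most #N − k points. -/
theorem succ_mul_level_succ_le {N : Finset α} {S : Finset (Finset α)} (hS : S ⊆ N.powerset)
    (hdown : ∀ s ∈ S, ∀ t ⊆ s, t ∈ S) (k : ℕ) :
    level S (k + 1) * (k + 1) ≤ level S k * (#N - k) := by
  refine card_mul_le_card_mul (fun s t : Finset α => t ⊆ s) ?_ ?_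
  · intro s hs
    obtain ⟨hsS, hsk⟩ := mem_filter.1 hs
    rw [← hsk, ← card_image_of_injOn (s := s) (f := fun x => s.erase x)]
    · refine card_le_card fun t ht => ?_
      obtain ⟨x, hx, rfl⟩ := mem_image.1 ht
      simp only [mem_bipartiteAbove, mem_filter]
      exact ⟨⟨hdown s hsS _ (erase_subset _ _), by rw [card_erase_of_mem hx]; omega⟩,
        erase_subset _ _⟩
    · exact erase_injOn s
  · intro t ht
    obtain ⟨htS, htk⟩ := mem_filter.1 ht
    have htN := mem_powerset.1 (hS htS)
    rw [← htk, ← card_sdiff_of_subset htN]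
    refine le_trans (card_le_card ?_) (card_image_le (s := N \ t) (f := fun x => insert x t))
    intro s hs
    simp only [mem_bipartiteBelow, mem_filter] at hs
    obtain ⟨⟨hsS, hsk⟩, hts⟩ := hs
    obtain ⟨x, hx, rfl⟩ := exists_eq_insert_iff.2 ⟨hts, by omega⟩
    exact mem_image.2 ⟨x, mem_sdiff.2 ⟨mem_powerset.1 (hS hsS) (mem_insert_self _ _), hx⟩, rfl⟩

/-- The local LYM inequality, in the normalised form that Chebyshev's inequality takes as input. -/
theorem antitoneOn_level_div_choose {N : Finset α} {S : Finset (Finset α)}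
    (hS : S ⊆ N.powerset) (hdown : ∀ s ∈ S, ∀ t ⊆ s, t ∈ S) :
    AntitoneOn (fun k => (level S k : ℝ) / (#N).choose k) (Icc 1 #N : Finset ℕ) := by
  rw [coe_Icc]
  refine antitoneOn_of_succ_le Set.ordConnected_Icc ?_
  intro k _ hk hk'
  simp only [Order.succ_eq_add_one, Set.mem_Icc] at hk hk' ⊢
  have h1 : (0 : ℝ) < (#N).choose k := by exact_mod_cast Nat.choose_pos hk.2
  have h2 : (0 : ℝ) < (#N).choose (k + 1) := by exact_mod_cast Nat.choose_pos hk'.2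
  have h3 : (0 : ℝ) < (#N : ℝ) - k := sub_pos.2 (by exact_mod_cast (by omega : k < #N))
  rw [div_le_div_iff₀ h2 h1]
  have e1 : ((#N).choose (k + 1) : ℝ) * (k + 1) = (#N).choose k * ((#N : ℝ) - k) := by
    have := Nat.choose_succ_right_eq #N k
    rw [← Nat.cast_sub hk.2]; exact_mod_cast this
  have e2 : (level S (k + 1) : ℝ) * (k + 1) ≤ level S k * ((#N : ℝ) - k) := by
    have := succ_mul_level_succ_le hS hdown k
    rw [← Nat.cast_sub hk.2]; exact_mod_cast this
  have h4 : (0 : ℝ) < k + 1 := by positivity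
  refine le_of_mul_le_mul_right ?_ h4
  calc (level S (k + 1) : ℝ) * (#N).choose k * (k + 1)
      = (level S (k + 1) * (k + 1)) * (#N).choose k := by ring
    _ ≤ (level S k * ((#N : ℝ) - k)) * (#N).choose k := by gcongr
    _ = level S k * ((#N).choose (k + 1) * (k + 1)) := by rw [e1]; ring
    _ = _ := by ring

theorem sum_nonempty_eq_sum_level {N : Finset α} {S : Finset (Finset α)}
    (hS : S ⊆ N.powerset) (g : ℕ → ℝ) :
    ∑ s ∈ S with s.Nonempty, g #s = ∑ k ∈ Icc 1 #N, level S k * g k := by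
  rw [← sum_fiberwise_of_maps_to (s := {s ∈ S | s.Nonempty}) (t := Icc 1 #N) (g := card)]
  · refine sum_congr rfl fun k hk => ?_
    rw [sum_congr rfl (g := fun _ => g k) (fun s hs => by rw [(mem_filter.1 hs).2]),
      sum_const, nsmul_eq_mul, level]
    congr 2
    congr 1
    ext s
    simp only [mem_filter, and_assoc]
    have := (mem_Icc.1 hk).1
    constructor
    · exact fun h => ⟨h.1, h.2.2⟩
    · exact fun h => ⟨h.1, card_pos.1 (by omega), h.2⟩
  · intro s hs
    obtain ⟨h1, h2⟩ := mem_filter.1 hs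
    exact mem_Icc.2 ⟨card_pos.2 h2, card_le_card (mem_powerset.1 (hS h1))⟩

theorem sum_choose_mul_pow (N : Finset α) (lam : ℝ) :
    ∑ k ∈ Icc 1 #N, ((#N).choose k : ℝ) * lam ^ k = (1 + lam) ^ #N - 1 := by
  have h := add_pow lam 1 #N
  rw [sum_range_eq_add_Ico _ (Nat.succ_pos _)] at h
  simp only [one_pow, mul_one, pow_zero, Nat.choose_zero_right, Nat.cast_one] at h
  rw [add_comm 1 lam, h, add_sub_cancel_left]
  exact sum_congr (by ext; simp) fun k _ => mul_comm _ _

/-- This is `lam` times the derivative of the binomial identity `sum_choose_mul_pow`. -/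
theorem sum_mul_choose_mul_pow (N : Finset α) (lam : ℝ) :
    ∑ k ∈ Icc 1 #N, (k : ℝ) * ((#N).choose k * lam ^ k) =
      #N * lam * (1 + lam) ^ (#N - 1) := by
  have h1 : HasDerivAt (fun x : ℝ => ∑ k ∈ Icc 1 #N, ((#N).choose k : ℝ) * x ^ k)
      (∑ k ∈ Icc 1 #N, ((#N).choose k : ℝ) * (k * lam ^ (k - 1))) lam :=
    HasDerivAt.fun_sum fun k _ => (hasDerivAt_pow k lam).const_mul _
  have h2 : HasDerivAt (fun x : ℝ => (1 + x) ^ #N - 1) (#N * (1 + lam) ^ (#N - 1) * 1) lam :=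
    (((hasDerivAt_id lam).const_add 1).pow #N).sub_const 1
  simp only [sum_choose_mul_pow] at h1
  have h3 := h1.unique h2
  calc ∑ k ∈ Icc 1 #N, (k : ℝ) * ((#N).choose k * lam ^ k)
      = lam * ∑ k ∈ Icc 1 #N, ((#N).choose k : ℝ) * (k * lam ^ (k - 1)) := by
        rw [mul_sum]
        refine sum_congr rfl fun k hk => ?_
        obtain ⟨j, rfl⟩ : ∃ j, k = j + 1 := ⟨k - 1, by have := (mem_Icc.1 hk).1; omega⟩
        simp only [Nat.add_sub_cancel, pow_succ]; ring
    _ = _ := by rw [h3]; ring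

/-- Among simplicial complexes on `N`, the full simplex maximises the mean size of a random
nonempty face. -/
theorem complex_ineq {N : Finset α} {S : Finset (Finset α)} (hN : 2 ≤ #N)
    (hS : S ⊆ N.powerset) (hdown : ∀ s ∈ S, ∀ t ⊆ s, t ∈ S) {lam : ℝ} (hl : 0 ≤ lam) :
    ((1 + lam) ^ #N - 1) * ∑ s ∈ S with s.Nonempty, (#s : ℝ) * lam ^ #s +
        (if (∃ y, {y} ∈ S) ∧ N ∉ S then lam ^ (#N + 1) else 0) ≤
      #N * lam * (1 + lam) ^ (#N - 1) * ∑ s ∈ S with s.Nonempty, lam ^ #s := by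
  set a : ℕ → ℝ := fun k => (level S k : ℝ) / (#N).choose k with ha
  set b : ℕ → ℝ := fun k => ((#N).choose k : ℝ) * lam ^ k with hb
  have hanti : AntitoneOn a (Icc 1 #N : Finset ℕ) := antitoneOn_level_div_choose hS hdown
  have hb0 : ∀ k ∈ Icc 1 #N, 0 ≤ b k := fun k _ => by positivity
  have h1N : 1 ∈ Icc 1 #N := mem_Icc.2 ⟨le_rfl, by omega⟩
  have hNN : #N ∈ Icc 1 #N := mem_Icc.2 ⟨by omega, le_rfl⟩
  have key := chebyshev_with_remainder hanti hb0 h1N hNN (by omega)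
  have hab : ∀ k ∈ Icc 1 #N, a k * b k = level S k * lam ^ k := fun k hk => by
    have : ((#N).choose k : ℝ) ≠ 0 := by
      exact_mod_cast (Nat.choose_pos (mem_Icc.1 hk).2).ne'
    simp only [ha, hb]; field_simp
  have e1 : ∑ k ∈ Icc 1 #N, a k * b k = ∑ s ∈ S with s.Nonempty, lam ^ #s := by
    rw [sum_nonempty_eq_sum_level hS fun k => lam ^ k]
    exact sum_congr rfl hab
  have e2 : ∑ k ∈ Icc 1 #N, (k : ℝ) * (a k * b k) =
      ∑ s ∈ S with s.Nonempty, (#s : ℝ) * lam ^ #s := by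
    rw [sum_nonempty_eq_sum_level hS fun k => (k : ℝ) * lam ^ k]
    exact sum_congr rfl fun k hk => by rw [hab k hk]; ring
  rw [e1, e2, sum_choose_mul_pow, sum_mul_choose_mul_pow] at key
  -- If there is a vertex but `N` is missing, then a 1 ≥ 1/#N and a #N = 0, while b 1 · b #N = #N ·
  -- lam ^ (#N + 1); the remaining factor #N − 1 is at least 1.
  have hrem : (if (∃ y, {y} ∈ S) ∧ N ∉ S then lam ^ (#N + 1) else 0) ≤
      ((#N : ℝ) - (1 : ℕ)) * (a 1 - a #N) * (b 1 * b #N) := by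
    have hN1 : (1 : ℝ) ≤ (#N : ℝ) - 1 := by
      have : (2 : ℝ) ≤ #N := by exact_mod_cast hN
      linarith
    split_ifs with h
    · obtain ⟨⟨y, hy⟩, hNS⟩ := h
      have hl1 : 1 ≤ level S 1 := card_pos.2 ⟨{y}, by simp [hy]⟩
      have hlN : level S #N = 0 := by
        rw [level, card_eq_zero, filter_eq_empty_iff]
        intro s hs hc
        exact hNS (eq_of_subset_of_card_le (mem_powerset.1 (hS hs)) hc.ge ▸ hs)
      have hN0 : (#N : ℝ) ≠ 0 := by positivity
      have hl1' : (1 : ℝ) ≤ level S 1 := by exact_mod_cast hl1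
      simp only [ha, hb, hlN, Nat.choose_one_right, Nat.choose_self, Nat.cast_zero, Nat.cast_one,
        zero_div, sub_zero, pow_one, one_mul]
      have : ((#N : ℝ) - 1) * (level S 1 / #N) * (#N * lam * lam ^ #N) =
          ((#N : ℝ) - 1) * level S 1 * lam ^ (#N + 1) := by field_simp; ring
      rw [this]
      have h3 : 1 ≤ ((#N : ℝ) - 1) * level S 1 := by nlinarith
      exact le_mul_of_one_le_left (by positivity) h3
    · refine mul_nonneg (mul_nonneg (by push_cast; linarith) (sub_nonneg.2 ?_))
        (mul_nonneg (hb0 _ h1N) (hb0 _ hNN))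
      exact hanti (by simpa using h1N) (by simpa using hNN) (by omega)
  linarith

/-- The inequality `complex_ineq` averaged over the links of a down-closed family. -/
theorem downset_ineq {F : Finset (Finset α)} (hF : ∀ s ∈ F, ∀ t ⊆ s, t ∈ F) {N : Finset α}
    (hN : 2 ≤ #N) (y : α) {lam : ℝ} (hl : 0 ≤ lam) :
    ((1 + lam) ^ #N - 1) * ∑ I ∈ F, (#(I ∩ N) : ℝ) * lam ^ #I +
        lam ^ #N * ∑ I ∈ F with I ∩ N = {y} ∧ (I \ N) ∪ N ∉ F, lam ^ #I ≤
      #N * lam * (1 + lam) ^ (#N - 1) * ∑ I ∈ F with (I ∩ N).Nonempty, lam ^ #I := by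
  rw [sum_filter, sum_filter]
  -- Group the members of `F` by their part `J` outside `N`; the traces compatible with `J` form a
  -- complex on `N`.
  have hfib : ∀ g : Finset α → ℝ,
      ∑ I ∈ F, g I = ∑ J ∈ F.image (· \ N), ∑ S ∈ N.powerset with J ∪ S ∈ F, g (J ∪ S) := by
    intro g
    rw [← sum_fiberwise_of_maps_to (s := F) (t := F.image (· \ N)) (g := (· \ N))
      (fun I hI => mem_image_of_mem _ hI)]
    refine sum_congr rfl fun J hJ => ?_
    obtain ⟨I₀, -, rfl⟩ := mem_image.1 hJ
    refine sum_nbij' (fun I => I ∩ N) (fun S => (I₀ \ N) ∪ S) ?_ ?_ ?_ ?_ ?_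
    · intro I hI
      obtain ⟨h1, h2⟩ := mem_filter.1 hI
      simp only [mem_filter, mem_powerset]
      exact ⟨inter_subset_right, by rw [← h2, sdiff_union_inter]; exact h1⟩
    · intro S hS
      obtain ⟨h1, h2⟩ := mem_filter.1 hS
      rw [mem_powerset] at h1
      simp only [mem_filter]
      refine ⟨h2, ?_⟩
      rw [union_sdiff_distrib, sdiff_eq_empty_iff_subset.2 h1, union_empty, Finset.sdiff_idem]
    · intro I hI
      obtain ⟨h1, h2⟩ := mem_filter.1 hI
      rw [← h2, sdiff_union_inter]
    · intro S hS
      obtain ⟨h1, h2⟩ := mem_filter.1 hS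
      rw [mem_powerset] at h1
      rw [union_inter_distrib_right, sdiff_inter_self, empty_union, inter_eq_left.2 h1]
    · intro I hI
      obtain ⟨h1, h2⟩ := mem_filter.1 hI
      rw [← h2, sdiff_union_inter]
  rw [hfib, hfib, hfib, mul_sum, mul_sum, mul_sum, ← sum_add_distrib]
  refine sum_le_sum fun J hJ => ?_
  obtain ⟨I₀, -, rfl⟩ := mem_image.1 hJ
  set J := I₀ \ N with hJdef
  have hdisj : ∀ S ∈ N.powerset, Disjoint J S := fun S hS =>
    disjoint_of_subset_right (mem_powerset.1 hS) sdiff_disjoint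
  have hint : ∀ S ∈ N.powerset, (J ∪ S) ∩ N = S := fun S hS => by
    rw [union_inter_distrib_right, hJdef, sdiff_inter_self, empty_union,
      inter_eq_left.2 (mem_powerset.1 hS)]
  have hsd : ∀ S ∈ N.powerset, (J ∪ S) \ N = J := fun S hS => by
    rw [union_sdiff_distrib, sdiff_eq_empty_iff_subset.2 (mem_powerset.1 hS), union_empty,
      hJdef, Finset.sdiff_idem]
  set C : Finset (Finset α) := {S ∈ N.powerset | J ∪ S ∈ F} with hC
  clear_value C
  have hCN : C ⊆ N.powerset := hC ▸ filter_subset _ _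
  have hCd : ∀ s ∈ C, ∀ t ⊆ s, t ∈ C := by
    intro s hs t ht
    rw [hC] at hs ⊢
    obtain ⟨h1, h2⟩ := mem_filter.1 hs
    exact mem_filter.2 ⟨mem_powerset.2 (ht.trans (mem_powerset.1 h1)),
      hF _ h2 _ (union_subset_union_right ht)⟩
  have hpow : ∀ S ∈ C, lam ^ #(J ∪ S) = lam ^ #J * lam ^ #S := fun S hS => by
    rw [card_union_of_disjoint (hdisj S (hCN hS)), pow_add]
  have key := mul_le_mul_of_nonneg_left (complex_ineq hN hCN hCd hl)
    (by positivity : 0 ≤ lam ^ #J)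
  have e1 : ∑ S ∈ C, (#((J ∪ S) ∩ N) : ℝ) * lam ^ #(J ∪ S) =
      lam ^ #J * ∑ s ∈ C with s.Nonempty, (#s : ℝ) * lam ^ #s := by
    rw [sum_filter, mul_sum]
    refine sum_congr rfl fun S hS => ?_
    rw [hint S (hCN hS), hpow S hS]
    split_ifs with h
    · ring
    · simp [not_nonempty_iff_eq_empty.1 h]
  have e2 : ∑ S ∈ C, (if ((J ∪ S) ∩ N).Nonempty then lam ^ #(J ∪ S) else 0) =
      lam ^ #J * ∑ s ∈ C with s.Nonempty, lam ^ #s := by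
    rw [sum_filter, mul_sum]
    refine sum_congr rfl fun S hS => ?_
    rw [hint S (hCN hS), hpow S hS, mul_ite, mul_zero]
  have e3 : lam ^ #N * ∑ S ∈ C, (if (J ∪ S) ∩ N = {y} ∧ ((J ∪ S) \ N) ∪ N ∉ F then
      lam ^ #(J ∪ S) else 0) ≤
      lam ^ #J * (if (∃ y, {y} ∈ C) ∧ N ∉ C then lam ^ (#N + 1) else 0) := by
    have e4 : ∀ S ∈ C, (if (J ∪ S) ∩ N = {y} ∧ ((J ∪ S) \ N) ∪ N ∉ F then
        lam ^ #(J ∪ S) else 0) = if S = {y} then (if N ∉ C then lam ^ #J * lam else 0) else 0 := by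
      intro S hS
      rw [hint S (hCN hS), hpow S hS, hsd S (hCN hS)]
      have : N ∉ C ↔ J ∪ N ∉ F := by simp [hC]
      by_cases h : S = {y}
      · subst h; simp [this]
      · simp [h]
    rw [sum_congr rfl e4, sum_ite_eq']
    by_cases h1 : {y} ∈ C
    · by_cases h2 : N ∈ C
      · simp [h2]
      · rw [if_pos h1, if_pos h2, if_pos ⟨⟨y, h1⟩, h2⟩]
        exact le_of_eq (by ring)
    · rw [if_neg h1, mul_zero]
      refine mul_nonneg (by positivity) ?_
      split_ifs <;> positivity
  rw [e1, e2]
  linarith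

end Complex

/-! ### The hard-core model -/

section Ind

variable {V : Type*} [Fintype V]

/-- The independent sets of a graph. -/
def indFam (G : SimpleGraph V) : Finset (Finset V) :=
  (univ : Finset (Finset V)).filter fun I : Finset V => G.IsIndepSet (I : Set V)

theorem Zind_eq (G : SimpleGraph V) (lam : ℝ) : Zind G lam = partFun (indFam G) lam := rfl

theorem mem_indFam {G : SimpleGraph V} {I : Finset V} :
    I ∈ indFam G ↔ ∀ x ∈ I, ∀ y ∈ I, ¬ G.Adj x y := by
  simp only [indFam, mem_filter, mem_univ, true_and]
  constructor
  · intro h x hx y hy hxy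
    exact h (by simpa using hx) (by simpa using hy) hxy.ne hxy
  · intro h x hx y hy _
    exact h x (by simpa using hx) y (by simpa using hy)

theorem empty_mem_indFam (G : SimpleGraph V) : ∅ ∈ indFam G := by simp [mem_indFam]

theorem indFam_down (G : SimpleGraph V) : ∀ s ∈ indFam G, ∀ t ⊆ s, t ∈ indFam G := by
  intro s hs t ht
  rw [mem_indFam] at *
  exact fun x hx y hy => hs x (ht hx) y (ht hy)

/-- If the closed neighbourhood of an independent set `T` lies in the window `W`, then `T` can
replace the trace of any independent set on `W`. -/
theorem sdiff_union_mem_indFam {G : SimpleGraph V} {T W : Finset V}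
    (hT : T ∈ indFam G) (hTW : ∀ x ∈ T, nbr G x ⊆ W) {I : Finset V} (hI : I ∈ indFam G) :
    (I \ W) ∪ T ∈ indFam G := by
  rw [mem_indFam] at *
  have key : ∀ x ∈ T, ∀ y ∈ I \ W, ¬ G.Adj x y := fun x hx y hy h =>
    (mem_sdiff.1 hy).2 (hTW x hx (by simpa using h))
  intro x hx y hy
  rcases mem_union.1 hx with hx | hx <;> rcases mem_union.1 hy with hy | hy
  · exact hI x (mem_sdiff.1 hx).1 y (mem_sdiff.1 hy).1
  · exact fun h => key y hy x hx h.symm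
  · exact key x hx y hy
  · exact hT x hx y hy

/-- The weight of the independent sets that witness a defect at `v` through its neighbour `y`. -/
def indDefect (G : SimpleGraph V) (v y : V) (lam : ℝ) : ℝ :=
  ∑ I ∈ indFam G with I ∩ nbr G v = {y} ∧ (I \ nbr G v) ∪ nbr G v ∉ indFam G, lam ^ #I

theorem indDefect_nonneg (G : SimpleGraph V) (v y : V) {lam : ℝ} (hl : 0 ≤ lam) :
    0 ≤ indDefect G v y lam := sum_nonneg fun _ _ => by positivity

theorem exists_indDefect_ge {G : SimpleGraph V} {d : ℕ} (hG : ∀ v, #(nbr G v) = d) {v : V}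
    (hv : ¬ IsGood G v) {lam : ℝ} (hl : 0 ≤ lam) :
    ∃ y, lam ^ 2 * partFun (indFam G) lam ≤ (1 + lam) ^ (3 * d + 4) * indDefect G v y lam := by
  have main : ∀ (y : V) (T W : Finset V), T ∈ indFam G → T ⊆ W → (∀ x ∈ T, nbr G x ⊆ W) →
      nbr G v ⊆ W → T ∩ nbr G v = {y} → #T ≤ 2 → #W ≤ 3 * d + 2 → 1 ≤ #T →
      (T \ nbr G v) ∪ nbr G v ∉ indFam G →
      lam ^ 2 * partFun (indFam G) lam ≤ (1 + lam) ^ (3 * d + 4) * indDefect G v y lam := by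
    intro y T W hT hTW hnb hvW hTy hT2 hW hT1 hdef
    have h1 := pow_mul_partFun_le_window (F := indFam G) hTW
      (fun I hI => sdiff_union_mem_indFam hT hnb hI) hl
    have hZ := partFun_pos (empty_mem_indFam G) hl
    have h2 : ∑ I ∈ indFam G with I ∩ W = T, lam ^ #I ≤ indDefect G v y lam := by
      refine sum_le_sum_of_subset_of_nonneg ?_ fun _ _ _ => by positivity
      intro I hI
      obtain ⟨hI, hIW⟩ := mem_filter.1 hI
      have hIv : I ∩ nbr G v = T ∩ nbr G v := by
        rw [← hIW, inter_assoc, inter_eq_right.2 hvW]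
      refine mem_filter.2 ⟨hI, hIv.trans hTy, fun h => hdef ?_⟩
      refine indFam_down G _ h _ (union_subset_union_left (sdiff_subset_sdiff ?_ le_rfl))
      rw [← hIW]; exact inter_subset_left
    -- The extra factor makes the bound uniform over patterns of one or two vertices; it accounts
    -- for 3d + 4 rather than 3d + 2 in the exponent.
    have h3 : lam ^ 2 ≤ (1 + lam) ^ 2 * lam ^ #T := by
      obtain h | h : #T = 1 ∨ #T = 2 := by omega
      · rw [h]; nlinarith [mul_nonneg hl hl, mul_nonneg (mul_nonneg hl hl) hl]
      · rw [h]; nlinarith [mul_nonneg hl (sq_nonneg lam), mul_nonneg (sq_nonneg lam) (sq_nonneg lam)]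
    calc lam ^ 2 * partFun (indFam G) lam
        ≤ (1 + lam) ^ 2 * lam ^ #T * partFun (indFam G) lam := by gcongr
      _ = (1 + lam) ^ 2 * (lam ^ #T * partFun (indFam G) lam) := by ring
      _ ≤ (1 + lam) ^ 2 * ((1 + lam) ^ #W * indDefect G v y lam) := by
          refine mul_le_mul_of_nonneg_left (h1.trans ?_) (by positivity)
          gcongr
      _ = (1 + lam) ^ (#W + 2) * indDefect G v y lam := by ring
      _ ≤ _ := by
          refine mul_le_mul_of_nonneg_right ?_ (indDefect_nonneg G v y hl)
          exact pow_le_pow_right₀ (by linarith) (by omega)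
  by_cases hind : ∀ u w, G.Adj v u → G.Adj v w → ¬ G.Adj u w
  · have h2 : ¬ ∀ u x, G.Adj v u → G.Adj u x → ∀ y, G.Adj v y → G.Adj x y :=
      fun h => hv ⟨hind, h⟩
    push Not at h2
    obtain ⟨u, x, hvu, hux, y, hvy, hxy⟩ := h2
    have hxv : ¬ G.Adj v x := fun h => hind u x hvu h hux
    have hne : x ≠ y := fun h => hxv (h ▸ hvy)
    -- The occupied `y` is the only trace on N(v), while the occupied `x` lies outside N(v) and
    -- blocks its neighbour `u`, so N(v) cannot be filled.
    refine ⟨y, main y {x, y} (nbr G v ∪ (nbr G x ∪ nbr G y) ∪ {x, y}) ?_ ?_ ?_ ?_ ?_ ?_ ?_ ?_ ?_⟩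
    · rw [mem_indFam]
      intro a ha b hb
      simp only [mem_insert, mem_singleton] at ha hb
      rcases ha with rfl | rfl <;> rcases hb with rfl | rfl
      · exact G.loopless.irrefl _
      · exact hxy
      · exact fun h => hxy h.symm
      · exact G.loopless.irrefl _
    · exact subset_union_right
    · intro a ha b hb
      simp only [mem_insert, mem_singleton] at ha
      rcases ha with rfl | rfl <;> simp_all
    · intro a ha; simp_all
    · ext a
      simp only [mem_inter, mem_insert, mem_singleton, mem_nbr]
      constructor
      · rintro ⟨rfl | rfl, h⟩
        · exact absurd h hxv
        · rfl
      · rintro rfl; exact ⟨Or.inr rfl, hvy⟩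
    · exact card_le_two
    · have c1 := card_union_le (nbr G v ∪ (nbr G x ∪ nbr G y)) {x, y}
      have c2 := card_union_le (nbr G v) (nbr G x ∪ nbr G y)
      have c3 := card_union_le (nbr G x) (nbr G y)
      have c4 : #({x, y} : Finset V) ≤ 2 := card_le_two
      rw [hG] at c2
      rw [hG, hG] at c3
      omega
    · exact card_pos.2 ⟨x, by simp⟩
    · rw [mem_indFam]
      exact fun h => h u (by simp [hvu]) x (by simp [hxv]) hux
  · push Not at hind
    obtain ⟨u, w, hvu, hvw, huw⟩ := hind
    -- Here N(v) contains the edge uw, so it can never be filled; it is enough to make the trace the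
    -- single vertex `u`.
    refine ⟨u, main u {u} (nbr G v ∪ nbr G u ∪ {u}) ?_ ?_ ?_ ?_ ?_ ?_ ?_ ?_ ?_⟩
    · rw [mem_indFam]; simp
    · exact subset_union_right
    · intro a ha b hb; simp_all
    · intro a ha; simp_all
    · ext a; simp only [mem_inter, mem_singleton, mem_nbr]
      exact ⟨fun h => h.1, fun h => ⟨h, h ▸ hvu⟩⟩
    · simp
    · have c1 := card_union_le (nbr G v ∪ nbr G u) {u}
      have c2 := card_union_le (nbr G v) (nbr G u)
      rw [card_singleton] at c1
      rw [hG, hG] at c2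
      omega
    · simp
    · rw [mem_indFam]
      exact fun h => h u (by simp [hvu]) w (by simp [hvw]) huw

/-! ### Summing the local inequality over all vertices -/

theorem sum_card_inter_nbr {G : SimpleGraph V} {d : ℕ} (hG : ∀ v, #(nbr G v) = d)
    (I : Finset V) : ∑ v, (#(I ∩ nbr G v) : ℝ) = d * #I := by
  have h1 : ∀ v, (#(I ∩ nbr G v) : ℝ) = ∑ u ∈ I, if G.Adj v u then (1 : ℝ) else 0 := by
    intro v
    rw [← sum_filter, sum_const, nsmul_eq_mul, mul_one]
    congr 2
    ext u; simp
  simp only [h1]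
  rw [sum_comm]
  have h2 : ∀ u ∈ I, ∑ v, (if G.Adj v u then (1 : ℝ) else 0) = d := by
    intro u _
    rw [← sum_filter, sum_const, nsmul_eq_mul, mul_one, ← hG u, nbr]
    congr 2
    ext v; simp [G.adj_comm]
  rw [sum_congr rfl h2, sum_const, nsmul_eq_mul, mul_comm]

theorem sum_sum_mem {α : Type*} [Fintype α] (F : Finset (Finset α)) (lam : ℝ) :
    ∑ v, ∑ I ∈ F with v ∈ I, lam ^ #I = lam * partDeriv F lam := by
  rw [mul_partDeriv]
  simp only [sum_filter]
  rw [sum_comm]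
  refine sum_congr rfl fun I _ => ?_
  simp [nsmul_eq_mul]

/-- If no neighbour of `v` is occupied, then `v` may be toggled freely, so it is occupied with
conditional probability lam / (1 + lam). -/
theorem mul_sum_inter_nbr_eq_empty (G : SimpleGraph V) (v : V) (lam : ℝ) :
    lam * ∑ I ∈ indFam G with I ∩ nbr G v = ∅, lam ^ #I =
      (1 + lam) * ∑ I ∈ indFam G with v ∈ I, lam ^ #I := by
  have hsub : ∀ I ∈ indFam G, v ∈ I → I ∩ nbr G v = ∅ := by
    intro I hI hv
    rw [mem_indFam] at hI
    refine eq_empty_of_forall_notMem fun x hx => ?_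
    rw [mem_inter, mem_nbr] at hx
    exact hI v hv x hx.1 hx.2
  have hbij : lam * ∑ I ∈ indFam G with I ∩ nbr G v = ∅ ∧ v ∉ I, lam ^ #I =
      ∑ I ∈ indFam G with v ∈ I, lam ^ #I := by
    rw [mul_sum]
    refine sum_nbij' (fun I => insert v I) (fun I => I.erase v) ?_ ?_ ?_ ?_ ?_
    · intro I hI
      obtain ⟨h1, h2, h3⟩ := mem_filter.1 hI
      refine mem_filter.2 ⟨?_, mem_insert_self _ _⟩
      rw [mem_indFam] at h1 ⊢
      have hvI : ∀ y ∈ I, ¬ G.Adj v y := fun y hy h => by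
        have : y ∈ I ∩ nbr G v := by simp [hy, h]
        rw [h2] at this
        simp at this
      intro x hx y hy
      rcases mem_insert.1 hx with hxv | hx <;> rcases mem_insert.1 hy with hyv | hy
      · rw [hxv, hyv]; exact G.loopless.irrefl _
      · rw [hxv]; exact hvI y hy
      · rw [hyv]; exact fun h => hvI x hx h.symm
      · exact h1 x hx y hy
    · intro I hI
      obtain ⟨h1, h2⟩ := mem_filter.1 hI
      refine mem_filter.2 ⟨indFam_down G _ h1 _ (erase_subset _ _), ?_, by simp⟩
      exact subset_empty.1 ((inter_subset_inter_right (erase_subset _ _)).trans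
        (hsub I h1 h2).subset)
    · intro I hI
      exact erase_insert (mem_filter.1 hI).2.2
    · intro I hI
      exact insert_erase (mem_filter.1 hI).2
    · intro I hI
      rw [card_insert_of_notMem (mem_filter.1 hI).2.2, pow_succ']
  have hsplit : ∑ I ∈ indFam G with I ∩ nbr G v = ∅, lam ^ #I =
      ∑ I ∈ indFam G with v ∈ I, lam ^ #I +
        ∑ I ∈ indFam G with I ∩ nbr G v = ∅ ∧ v ∉ I, lam ^ #I := by
    simp only [sum_filter]
    rw [← sum_add_distrib]
    refine sum_congr rfl fun I hI => ?_
    by_cases h : v ∈ I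
    · simp [h, hsub I hI h]
    · simp [h]
  rw [hsplit, mul_add, hbij]
  ring

theorem sum_sum_inter_nonempty (G : SimpleGraph V) {lam : ℝ} (hl : 0 < lam) :
    ∑ v, ∑ I ∈ indFam G with (I ∩ nbr G v).Nonempty, lam ^ #I =
      Fintype.card V * partFun (indFam G) lam - (1 + lam) * partDeriv (indFam G) lam := by
  have h1 : ∀ v, ∑ I ∈ indFam G with (I ∩ nbr G v).Nonempty, lam ^ #I =
      partFun (indFam G) lam - ∑ I ∈ indFam G with I ∩ nbr G v = ∅, lam ^ #I := by
    intro v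
    rw [partFun, sum_filter, sum_filter, ← sum_sub_distrib]
    refine sum_congr rfl fun I _ => ?_
    by_cases h : I ∩ nbr G v = ∅
    · simp [h]
    · simp [h, nonempty_iff_ne_empty]
  have h2 : ∑ v, ∑ I ∈ indFam G with I ∩ nbr G v = ∅, lam ^ #I =
      (1 + lam) * partDeriv (indFam G) lam := by
    refine mul_left_cancel₀ hl.ne' ?_
    rw [mul_sum]
    simp only [mul_sum_inter_nbr_eq_empty]
    rw [← mul_sum, sum_sum_mem]
    ring
  simp only [h1, sum_sub_distrib, h2, sum_const, card_univ, nsmul_eq_mul]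

theorem indFam_occupancy {G : SimpleGraph V} {d : ℕ} (hd : 2 ≤ d) (hG : ∀ v, #(nbr G v) = d)
    {lam : ℝ} (hl : 0 < lam) :
    lam ^ (d + 1) / (d * (1 + lam) ^ (3 * d + 4)) * #(bad G) * partFun (indFam G) lam ≤
      (1 + lam) ^ (d - 1) * (Fintype.card V * partFun (indFam G) lam) -
        (2 * (1 + lam) ^ d - 1) * partDeriv (indFam G) lam := by
  set Z := partFun (indFam G) lam with hZ
  have hex : ∀ v, ∃ y, (if v ∈ bad G then lam ^ 2 * Z / (1 + lam) ^ (3 * d + 4) else 0) ≤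
      indDefect G v y lam := by
    intro v
    split_ifs with h
    · obtain ⟨y, hy⟩ := exists_indDefect_ge hG (v := v) (by simpa [bad] using h) hl.le
      exact ⟨y, by rw [div_le_iff₀ (by positivity)]; linarith⟩
    -- At a good vertex only nonnegativity is needed, so the choice of witness is arbitrary.
    · exact ⟨v, indDefect_nonneg _ _ _ hl.le⟩
  choose y hy using hex
  have hv : ∀ v, ((1 + lam) ^ d - 1) * ∑ I ∈ indFam G, (#(I ∩ nbr G v) : ℝ) * lam ^ #I +
      lam ^ d * (if v ∈ bad G then lam ^ 2 * Z / (1 + lam) ^ (3 * d + 4) else 0) ≤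
      d * lam * (1 + lam) ^ (d - 1) *
        ∑ I ∈ indFam G with (I ∩ nbr G v).Nonempty, lam ^ #I := by
    intro v
    have h := downset_ineq (indFam_down G) (N := nbr G v) (by rw [hG]; exact hd) (y v) hl.le
    rw [hG] at h
    refine le_trans ?_ h
    gcongr
    exact hy v
  have hsum := sum_le_sum fun v (_ : v ∈ (univ : Finset V)) => hv v
  rw [sum_add_distrib, ← mul_sum, ← mul_sum, ← mul_sum, sum_sum_inter_nonempty G hl,
    sum_ite_mem, univ_inter, sum_const, nsmul_eq_mul, sum_comm] at hsum
  have e1 : ∑ I ∈ indFam G, ∑ v, (#(I ∩ nbr G v) : ℝ) * lam ^ #I =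
      d * (lam * partDeriv (indFam G) lam) := by
    rw [mul_partDeriv, mul_sum]
    refine sum_congr rfl fun I _ => ?_
    rw [← sum_mul, sum_card_inter_nbr hG]; ring
  rw [e1, ← hZ] at hsum
  have hA : (1 + lam) ^ d = (1 + lam) ^ (d - 1) * (1 + lam) := by
    rw [← pow_succ]; congr 1; omega
  have hd0 : (0 : ℝ) < d := by positivity
  -- Every term carries the factor d · lam. The two coefficients of the derivative, (1 + lam) ^ d −
  -- 1 and (1 + lam) ^ d, add up to the partition function of K_{d,d}.
  refine le_of_mul_le_mul_left ?_ (mul_pos hd0 hl)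
  have e2 : d * lam * (lam ^ (d + 1) / (d * (1 + lam) ^ (3 * d + 4)) * #(bad G) * Z) =
      lam ^ d * (#(bad G) * (lam ^ 2 * Z / (1 + lam) ^ (3 * d + 4))) := by
    field_simp
    ring
  rw [e2]
  rw [hA] at hsum ⊢
  linarith

/-! ### The independence polynomial of K_{d,d} and the resulting rate -/

theorem partFun_indFam_completeBipartiteGraph (d : ℕ) (lam : ℝ) :
    partFun (indFam (completeBipartiteGraph (Fin d) (Fin d))) lam = 2 * (1 + lam) ^ d - 1 := by
  set L : Finset (Fin d ⊕ Fin d) := univ.map Function.Embedding.inl with hL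
  set R : Finset (Fin d ⊕ Fin d) := univ.map Function.Embedding.inr with hR
  have hfam : indFam (completeBipartiteGraph (Fin d) (Fin d)) = L.powerset ∪ R.powerset := by
    ext I
    rw [mem_indFam, mem_union, mem_powerset, mem_powerset]
    constructor
    · intro h
      by_contra hc
      rw [not_or, not_subset, not_subset] at hc
      obtain ⟨⟨x, hx, hxL⟩, y, hy, hyR⟩ := hc
      have := h x hx y hy
      rcases x with x | x <;> rcases y with y | y <;> simp_all
    · rintro h x hx y hy
      · rcases h with h | h
        · have h1 := h hx
          have h2 := h hy
          rcases x with x | x <;> rcases y with y | y <;> simp_all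
        · have h1 := h hx
          have h2 := h hy
          rcases x with x | x <;> rcases y with y | y <;> simp_all
  have hpow : ∀ N : Finset (Fin d ⊕ Fin d), ∑ S ∈ N.powerset, lam ^ #S = (1 + lam) ^ #N := by
    intro N
    have := sum_pow_mul_eq_add_pow lam 1 N
    simp only [one_pow, mul_one] at this
    rw [this, add_comm]
  have hint : L.powerset ∩ R.powerset = {∅} := by
    have hmem : ∀ S, S ∈ L.powerset ∩ R.powerset ↔ S ⊆ L ∩ R := fun S => by
      rw [mem_inter, mem_powerset, mem_powerset, subset_inter_iff]
    have : L ∩ R = ∅ := by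
      ext x; rcases x with x | x <;> simp [hL, hR]
    ext S
    rw [hmem, this, subset_empty, mem_singleton]
  have h := sum_union_inter (s₁ := L.powerset) (s₂ := R.powerset) (f := fun S => lam ^ #S)
  rw [hint, hpow, hpow] at h
  simp only [sum_singleton, card_empty, pow_zero, hL, hR, card_map, card_univ,
    Fintype.card_fin] at h
  rw [partFun, hfam]
  linarith

theorem partDeriv_indFam_completeBipartiteGraph (d : ℕ) (lam : ℝ) :
    partDeriv (indFam (completeBipartiteGraph (Fin d) (Fin d))) lam =
      2 * d * (1 + lam) ^ (d - 1) := by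
  have h1 := hasDerivAt_partFun (indFam (completeBipartiteGraph (Fin d) (Fin d))) lam
  have h2 : HasDerivAt (fun x : ℝ => 2 * (1 + x) ^ d - 1) (2 * (d * (1 + lam) ^ (d - 1) * 1)) lam :=
    ((((hasDerivAt_id lam).const_add 1).pow d).const_mul 2).sub_const 1
  rw [funext (partFun_indFam_completeBipartiteGraph d)] at h1
  rw [h1.unique h2]
  ring

/-- The rate of the stability bound for independent sets. -/
def indRate (d : ℕ) (lam : ℝ) : ℝ :=
  lam ^ (d + 1) / (d * (1 + lam) ^ (3 * d + 4)) / (2 * (1 + lam) ^ d - 1)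

theorem two_mul_pow_sub_one_pos (d : ℕ) {lam : ℝ} (hl : 0 ≤ lam) :
    0 < 2 * (1 + lam) ^ d - 1 := by
  have : 1 ≤ (1 + lam) ^ d := one_le_pow₀ (by linarith)
  linarith

theorem continuousOn_indRate {d : ℕ} (hd : 0 < d) : ContinuousOn (indRate d) (Set.Ici 0) := by
  refine ContinuousOn.div (ContinuousOn.div (by fun_prop) (by fun_prop) ?_) (by fun_prop) ?_
  · intro x hx
    have : (0 : ℝ) < 1 + x := by have : (0 : ℝ) ≤ x := hx; linarith
    positivity
  · intro x hx
    exact (two_mul_pow_sub_one_pos d hx).ne'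

theorem indRate_pos {d : ℕ} (hd : 0 < d) {lam : ℝ} (hl : 0 < lam) : 0 < indRate d lam :=
  div_pos (by positivity) (two_mul_pow_sub_one_pos d hl.le)

theorem ind_deriv_le [Nonempty V] {G : SimpleGraph V} {d : ℕ} (hd : 2 ≤ d)
    (hG : ∀ v, #(nbr G v) = d) {lam : ℝ} (hl : 0 < lam) :
    1 / (Fintype.card V : ℝ) * (partDeriv (indFam G) lam / partFun (indFam G) lam) +
        indRate d lam * (#(bad G) / (Fintype.card V : ℝ)) ≤
      1 / (2 * (d : ℝ)) * (partDeriv (indFam (completeBipartiteGraph (Fin d) (Fin d))) lam /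
        partFun (indFam (completeBipartiteGraph (Fin d) (Fin d))) lam) := by
  have h := indFam_occupancy hd hG hl
  have hn : (0 : ℝ) < Fintype.card V := by exact_mod_cast Fintype.card_pos
  have hZ := partFun_pos (empty_mem_indFam G) hl.le
  have hA := two_mul_pow_sub_one_pos d hl.le
  rw [partDeriv_indFam_completeBipartiteGraph, partFun_indFam_completeBipartiteGraph, indRate]
  set Z := partFun (indFam G) lam
  set Z' := partDeriv (indFam G) lam
  set A := 2 * (1 + lam) ^ d - 1
  set q := lam ^ (d + 1) / (d * (1 + lam) ^ (3 * d + 4))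
  have hd0 : (0 : ℝ) < d := by positivity
  have e1 : 1 / (2 * (d : ℝ)) * (2 * d * (1 + lam) ^ (d - 1) / A) =
      ((1 + lam) ^ (d - 1) * (Fintype.card V * Z)) / (A * (Fintype.card V * Z)) := by
    field_simp
  have e2 : 1 / (Fintype.card V : ℝ) * (Z' / Z) + q / A * (#(bad G) / (Fintype.card V : ℝ)) =
      (A * Z' + q * #(bad G) * Z) / (A * (Fintype.card V * Z)) := by
    field_simp
  rw [e1, e2]
  gcongr
  linarith

end Ind

/-! ### The monomer-dimer model: exchange identities -/

section Match

variable {V : Type*} [Fintype V]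

/-- The matchings of a graph. -/
def matchFam (G : SimpleGraph V) : Finset (Finset (Sym2 V)) :=
  (univ : Finset (Finset (Sym2 V))).filter fun M : Finset (Sym2 V) => IsMatchingSet G M

theorem Zmatch_eq (G : SimpleGraph V) (lam : ℝ) : Zmatch G lam = partFun (matchFam G) lam := rfl

theorem mem_matchFam {G : SimpleGraph V} {M : Finset (Sym2 V)} :
    M ∈ matchFam G ↔ IsMatchingSet G M := by simp [matchFam]

theorem empty_mem_matchFam (G : SimpleGraph V) : ∅ ∈ matchFam G := by
  simp [mem_matchFam, IsMatchingSet]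

/-- The vertices not covered by a set of edges. -/
def unc (M : Finset (Sym2 V)) : Finset V := {u | ∀ e ∈ M, u ∉ e}

theorem mem_unc {M : Finset (Sym2 V)} {u : V} : u ∈ unc M ↔ ∀ e ∈ M, u ∉ e := by simp [unc]

/-- The ordered pairs of end vertices of the members of a set of edges. -/
def arcs (M : Finset (Sym2 V)) : Finset (V × V) := {p | s(p.1, p.2) ∈ M}

theorem mem_arcs {M : Finset (Sym2 V)} {p : V × V} : p ∈ arcs M ↔ s(p.1, p.2) ∈ M := by
  simp [arcs]

/-- The ordered adjacent pairs inside a set of vertices. -/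
def arcsIn (G : SimpleGraph V) (U : Finset V) : Finset (V × V) :=
  {p | p.1 ∈ U ∧ p.2 ∈ U ∧ G.Adj p.1 p.2}

theorem mem_arcsIn {G : SimpleGraph V} {U : Finset V} {p : V × V} :
    p ∈ arcsIn G U ↔ p.1 ∈ U ∧ p.2 ∈ U ∧ G.Adj p.1 p.2 := by simp [arcsIn]

theorem sum_arcsIn (G : SimpleGraph V) (U : Finset V) (f : V × V → ℝ) :
    ∑ p ∈ arcsIn G U, f p = ∑ v ∈ U, ∑ w ∈ U ∩ nbr G v, f (v, w) :=
  sum_finset_product _ _ _ fun p => by simp [mem_arcsIn]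

theorem sum_sum_nbr_comm (G : SimpleGraph V) (U : Finset V) (f : V → V → ℝ) :
    ∑ v ∈ U, ∑ w ∈ U ∩ nbr G v, f v w = ∑ w ∈ U, ∑ v ∈ U ∩ nbr G w, f v w :=
  sum_comm' fun v w => by simp [G.adj_comm]; tauto

variable {G : SimpleGraph V}

theorem card_arcs {M : Finset (Sym2 V)} (hM : M ∈ matchFam G) : #(arcs M) = 2 * #M := by
  rw [mem_matchFam] at hM
  rw [card_eq_sum_card_fiberwise (f := fun p : V × V => s(p.1, p.2)) (t := M)
    (fun p hp => by simpa [mem_arcs] using hp), mul_comm, ← smul_eq_mul, ← sum_const]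
  refine sum_congr rfl fun e he => ?_
  induction e using Sym2.ind with
  | _ x y =>
    have hxy : x ≠ y := by
      have := hM.1 _ he
      rw [SimpleGraph.mem_edgeSet] at this
      exact this.ne
    have : {p ∈ arcs M | s(p.1, p.2) = s(x, y)} = {(x, y), (y, x)} := by
      ext ⟨a, b⟩
      simp only [mem_filter, mem_arcs, mem_insert, mem_singleton, Sym2.eq_iff, Prod.mk.injEq]
      constructor
      · exact fun h => h.2
      · rintro (⟨rfl, rfl⟩ | ⟨rfl, rfl⟩)
        · exact ⟨he, by simp⟩
        · exact ⟨by rwa [Sym2.eq_swap], by simp⟩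
    rw [this, card_pair (by simp [hxy])]

/-- Each covered vertex is the first end of exactly one arc, since it lies in exactly one matching
edge. -/
theorem sum_covered {M : Finset (Sym2 V)} (hM : M ∈ matchFam G) (h : V → ℝ) :
    ∑ v ∈ (unc M)ᶜ, h v = ∑ p ∈ arcs M, h p.1 := by
  rw [mem_matchFam] at hM
  symm
  refine sum_nbij (fun p => p.1) ?_ ?_ ?_ fun _ _ => rfl
  · intro p hp
    rw [mem_arcs] at hp
    rw [mem_compl, mem_unc]
    exact fun h => h _ hp (Sym2.mem_mk_left _ _)
  · rintro ⟨a, b⟩ hp ⟨a', b'⟩ hq (rfl : a = a')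
    rw [mem_coe, mem_arcs] at hp hq
    have := hM.2 _ hp _ hq a (Sym2.mem_mk_left _ _) (Sym2.mem_mk_left _ _)
    rw [Sym2.congr_right] at this
    exact Prod.ext rfl this
  · intro v hv
    rw [mem_coe, mem_compl, mem_unc] at hv
    push Not at hv
    obtain ⟨e, he, hve⟩ := hv
    obtain ⟨w, rfl⟩ := hve
    exact ⟨(v, w), by simpa [mem_arcs] using he, rfl⟩

theorem insert_mem_matchFam {M : Finset (Sym2 V)} (hM : M ∈ matchFam G) {p : V × V}
    (hp : p ∈ arcsIn G (unc M)) : insert s(p.1, p.2) M ∈ matchFam G := by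
  rw [mem_matchFam] at hM ⊢
  rw [mem_arcsIn, mem_unc, mem_unc] at hp
  obtain ⟨h1, h2, h3⟩ := hp
  have key : ∀ e ∈ M, ∀ v, v ∈ e → v ∉ s(p.1, p.2) := by
    intro e he v hv hvp
    rcases Sym2.mem_iff.1 hvp with rfl | rfl
    · exact h1 e he hv
    · exact h2 e he hv
  refine ⟨?_, ?_⟩
  · intro e he
    rcases mem_insert.1 he with rfl | he
    · exact h3
    · exact hM.1 e he
  · intro e he f hf v hve hvf
    rcases mem_insert.1 he with he | he <;> rcases mem_insert.1 hf with hf | hf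
    · rw [he, hf]
    · exact absurd (he ▸ hve) (key f hf v hvf)
    · exact absurd (hf ▸ hvf) (key e he v hve)
    · exact hM.2 e he f hf v hve hvf

theorem notMem_of_mem_arcsIn_unc {M : Finset (Sym2 V)} {p : V × V}
    (hp : p ∈ arcsIn G (unc M)) : s(p.1, p.2) ∉ M := fun h =>
  mem_unc.1 (mem_arcsIn.1 hp).1 _ h (Sym2.mem_mk_left _ _)

theorem unc_insert (M : Finset (Sym2 V)) (v w : V) :
    unc (insert s(v, w) M) = unc M \ {v, w} := by
  ext x
  simp only [mem_unc, mem_insert, forall_eq_or_imp, mem_sdiff, mem_singleton, Sym2.mem_iff]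
  tauto

/-- Adding an edge between uncovered vertices is inverse to removing an edge of a matching. -/
theorem sum_arcs_exchange (G : SimpleGraph V) (f : Finset (Sym2 V) → V × V → ℝ) :
    ∑ M ∈ matchFam G, ∑ p ∈ arcs M, f M p =
      ∑ M ∈ matchFam G, ∑ p ∈ arcsIn G (unc M), f (insert s(p.1, p.2) M) p := by
  rw [sum_sigma', sum_sigma']
  refine sum_nbij' (fun x => ⟨x.1.erase s(x.2.1, x.2.2), x.2⟩)
    (fun x => ⟨insert s(x.2.1, x.2.2) x.1, x.2⟩) ?_ ?_ ?_ ?_ ?_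
  · rintro ⟨M, v, w⟩ hx
    simp only [mem_sigma, mem_arcs] at hx ⊢
    obtain ⟨hM, hp⟩ := hx
    rw [mem_matchFam] at hM ⊢
    refine ⟨⟨fun e he => hM.1 e (mem_of_mem_erase he), fun e he f hf =>
      hM.2 e (mem_of_mem_erase he) f (mem_of_mem_erase hf)⟩, ?_⟩
    rw [mem_arcsIn, mem_unc, mem_unc]
    refine ⟨fun e he hv => ?_, fun e he hv => ?_, hM.1 _ hp⟩
    · exact ne_of_mem_erase he (hM.2 e (mem_of_mem_erase he) _ hp v hv (Sym2.mem_mk_left _ _))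
    · exact ne_of_mem_erase he (hM.2 e (mem_of_mem_erase he) _ hp w hv (Sym2.mem_mk_right _ _))
  · rintro ⟨M, p⟩ hx
    simp only [mem_sigma] at hx ⊢
    exact ⟨insert_mem_matchFam hx.1 hx.2, by simp [mem_arcs]⟩
  · rintro ⟨M, p⟩ hx
    simp only [mem_sigma, mem_arcs] at hx
    simp only [insert_erase hx.2]
  · rintro ⟨M, p⟩ hx
    simp only [mem_sigma] at hx
    simp only [erase_insert (notMem_of_mem_arcsIn_unc hx.2)]
  · rintro ⟨M, p⟩ hx
    simp only [mem_sigma, mem_arcs] at hx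
    simp only [insert_erase hx.2]

theorem sum_card_unc (G : SimpleGraph V) (lam : ℝ) :
    ∑ M ∈ matchFam G, lam ^ #M * (#(unc M) : ℝ) =
      Fintype.card V * partFun (matchFam G) lam - 2 * (lam * partDeriv (matchFam G) lam) := by
  rw [mul_partDeriv, partFun, mul_sum, mul_sum, ← sum_sub_distrib]
  refine sum_congr rfl fun M hM => ?_
  have h := sum_covered hM (fun _ => 1)
  simp only [sum_const, nsmul_eq_mul, mul_one, card_arcs hM] at h
  have h2 : (#(unc M)ᶜ : ℝ) = Fintype.card V - #(unc M) := by
    rw [card_compl, Nat.cast_sub (card_le_univ _)]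
  rw [h2] at h
  push_cast at h
  linear_combination (-lam ^ #M) * h

/-- An ordered adjacent uncovered pair of `M` is the same as a larger matching with one of its edges
marked and oriented. -/
theorem sum_degree_unc (G : SimpleGraph V) (lam : ℝ) :
    ∑ M ∈ matchFam G, lam ^ #M * ∑ u ∈ unc M, (#(unc M ∩ nbr G u) : ℝ) =
      2 * partDeriv (matchFam G) lam := by
  have h := sum_arcs_exchange G (fun M _ => lam ^ (#M - 1))
  have h1 : ∑ M ∈ matchFam G, ∑ p ∈ arcs M, lam ^ (#M - 1) = 2 * partDeriv (matchFam G) lam := by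
    rw [partDeriv, mul_sum]
    refine sum_congr rfl fun M hM => ?_
    rw [sum_const, card_arcs hM, nsmul_eq_mul]
    push_cast
    ring
  rw [← h1, h]
  refine sum_congr rfl fun M hM => ?_
  have e : ∀ p ∈ arcsIn G (unc M), lam ^ (#(insert s(p.1, p.2) M) - 1) = lam ^ #M :=
    fun p hp => by
      rw [card_insert_of_notMem (notMem_of_mem_arcsIn_unc hp), Nat.add_sub_cancel]
  rw [sum_congr rfl e, sum_arcsIn, mul_sum]
  refine sum_congr rfl fun u _ => ?_
  rw [sum_const, nsmul_eq_mul, mul_comm]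

/-- The local energy of the ordered edge `(u, v)` in the graph induced on `U`. -/
def edgeEnergy (G : SimpleGraph V) (B : ℕ → ℝ) (U : Finset V) (u v : V) : ℝ :=
  1 / 2 * (((#(U ∩ nbr G v) : ℝ) - #(U ∩ nbr G u)) *
      (B (#(U ∩ nbr G u) - 1) - B (#(U ∩ nbr G v) - 1))) +
    #(U ∩ nbr G u ∩ nbr G v) * (B (#(U ∩ nbr G u) - 2) - B (#(U ∩ nbr G u) - 1))

/-- The energy of the graph induced on `U`. -/
def energy (G : SimpleGraph V) (B : ℕ → ℝ) (U : Finset V) : ℝ :=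
  ∑ u ∈ U, ∑ v ∈ U ∩ nbr G u, edgeEnergy G B U u v

/-- Exchanging `u` and `v` undoes the symmetrisation: the one-sided form is what path counting
yields, the symmetric form is what has a sign. -/
theorem energy_eq (G : SimpleGraph V) (B : ℕ → ℝ) (U : Finset V) :
    energy G B U = ∑ u ∈ U, ∑ v ∈ U ∩ nbr G u,
      (((#(U ∩ nbr G v) : ℝ) - #(U ∩ nbr G u)) * B (#(U ∩ nbr G u) - 1) +
        #(U ∩ nbr G u ∩ nbr G v) * (B (#(U ∩ nbr G u) - 2) - B (#(U ∩ nbr G u) - 1))) := by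
  have hsym := sum_sum_nbr_comm G U fun u v =>
    ((#(U ∩ nbr G v) : ℝ) - #(U ∩ nbr G u)) * B (#(U ∩ nbr G u) - 1)
  have e : energy G B U = ∑ u ∈ U, ∑ v ∈ U ∩ nbr G u,
      (1 / 2 * (((#(U ∩ nbr G v) : ℝ) - #(U ∩ nbr G u)) * B (#(U ∩ nbr G u) - 1)) +
        1 / 2 * (((#(U ∩ nbr G u) : ℝ) - #(U ∩ nbr G v)) * B (#(U ∩ nbr G v) - 1)) +
        #(U ∩ nbr G u ∩ nbr G v) * (B (#(U ∩ nbr G u) - 2) - B (#(U ∩ nbr G u) - 1))) := by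
    unfold energy edgeEnergy
    refine sum_congr rfl fun u _ => sum_congr rfl fun v _ => ?_
    ring
  rw [e]
  simp only [sum_add_distrib, ← mul_sum]
  rw [← hsym]
  ring

theorem card_sdiff_pair_inter_nbr {U : Finset V} {u v w : V} (hv : v ∈ U) (hw : w ∈ U)
    (huv : G.Adj u v) (hvw : v ≠ w) :
    #((U \ {v, w}) ∩ nbr G u) = #(U ∩ nbr G u) - if G.Adj u w then 2 else 1 := by
  have h1 : (U \ {v, w}) ∩ nbr G u = (U ∩ nbr G u) \ ({v, w} ∩ nbr G u) := by
    ext x; simp only [mem_inter, mem_sdiff]; tauto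
  rw [h1, card_sdiff_of_subset]
  · congr 1
    split_ifs with h
    · rw [inter_eq_left.2 (by intro x hx; simp only [mem_insert, mem_singleton] at hx
                              rcases hx with rfl | rfl <;> simpa), card_pair hvw]
    · have : ({v, w} : Finset V) ∩ nbr G u = {v} := by
        ext x
        simp only [mem_inter, mem_insert, mem_singleton, mem_nbr]
        constructor
        · rintro ⟨rfl | rfl, hx⟩
          · rfl
          · exact absurd hx h
        · rintro rfl; exact ⟨Or.inl rfl, huv⟩
      rw [this, card_singleton]
  · refine inter_subset_inter_right ?_
    intro x hx; simp only [mem_insert, mem_singleton] at hx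
    rcases hx with rfl | rfl <;> assumption

/-- The sum runs over paths u–v–w in `U` and is regrouped by `u`. Given u and v there are Y_v − 1
choices of w, where Y is the degree inside `U`; deleting v and w lowers Y_u by 1, or by 2 if w
closes a triangle. Replacing Y_v − 1 by Y_u − 1 gives the main term, and the error is the energy. -/
theorem sum_path_eq (G : SimpleGraph V) (B : ℕ → ℝ) (U : Finset V) :
    ∑ p ∈ arcsIn G U, ∑ u ∈ (U \ {p.1, p.2}) ∩ nbr G p.1, B #((U \ {p.1, p.2}) ∩ nbr G u) =
      ∑ u ∈ U, (#(U ∩ nbr G u) : ℝ) * ((#(U ∩ nbr G u) : ℝ) - 1) * B (#(U ∩ nbr G u) - 1) +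
        energy G B U := by
  have inner : ∀ u ∈ U, ∀ v ∈ U ∩ nbr G u,
      ∑ w ∈ (U ∩ nbr G v).erase u, B #((U \ {v, w}) ∩ nbr G u) =
        ((#(U ∩ nbr G v) : ℝ) - 1) * B (#(U ∩ nbr G u) - 1) +
        #(U ∩ nbr G u ∩ nbr G v) * (B (#(U ∩ nbr G u) - 2) - B (#(U ∩ nbr G u) - 1)) := by
    intro u hu v hv
    obtain ⟨hvU, huv⟩ := mem_inter.1 hv
    rw [mem_nbr] at huv
    have hc : ∀ w ∈ (U ∩ nbr G v).erase u, B #((U \ {v, w}) ∩ nbr G u) =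
        B (#(U ∩ nbr G u) - 1) +
          if G.Adj u w then B (#(U ∩ nbr G u) - 2) - B (#(U ∩ nbr G u) - 1) else 0 := by
      intro w hw
      obtain ⟨_, hw⟩ := mem_erase.1 hw
      obtain ⟨hwU, hvw⟩ := mem_inter.1 hw
      rw [mem_nbr] at hvw
      rw [card_sdiff_pair_inter_nbr hvU hwU huv hvw.ne]
      split_ifs
      · rw [add_sub_cancel]
      · rw [add_zero]
    have hu' : u ∈ U ∩ nbr G v := by simp [hu, huv.symm]
    rw [sum_congr rfl hc, sum_add_distrib, sum_const, ← sum_filter, sum_const,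
      card_erase_of_mem hu', nsmul_eq_mul, nsmul_eq_mul, Nat.cast_sub (card_pos.2 ⟨u, hu'⟩)]
    congr 3
    · simp
    · congr 1
      ext w
      simp only [mem_filter, mem_erase, mem_inter, mem_nbr]
      constructor
      · tauto
      · rintro ⟨⟨h1, h2⟩, h3⟩
        exact ⟨⟨h2.ne', h1, h3⟩, h2⟩
  calc ∑ p ∈ arcsIn G U, ∑ u ∈ (U \ {p.1, p.2}) ∩ nbr G p.1, B #((U \ {p.1, p.2}) ∩ nbr G u)
      = ∑ v ∈ U, ∑ w ∈ U ∩ nbr G v, ∑ u ∈ (U ∩ nbr G v).erase w,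
          B #((U \ {v, w}) ∩ nbr G u) := by
        rw [sum_arcsIn]
        refine sum_congr rfl fun v _ => sum_congr rfl fun w _ => sum_congr ?_ fun _ _ => rfl
        ext x
        simp only [mem_inter, mem_sdiff, mem_insert, mem_singleton, mem_erase, mem_nbr]
        constructor
        · tauto
        · rintro ⟨h1, h2, h3⟩
          exact ⟨⟨h2, fun h => h.elim (fun h => h3.ne h.symm) h1⟩, h3⟩
    _ = ∑ v ∈ U, ∑ u ∈ U ∩ nbr G v, ∑ w ∈ (U ∩ nbr G v).erase u,
          B #((U \ {v, w}) ∩ nbr G u) := by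
        refine sum_congr rfl fun v _ => sum_comm' fun w u => ?_
        simp only [mem_erase]
        tauto
    _ = ∑ u ∈ U, ∑ v ∈ U ∩ nbr G u, ∑ w ∈ (U ∩ nbr G v).erase u,
          B #((U \ {v, w}) ∩ nbr G u) := sum_sum_nbr_comm G U _
    _ = ∑ u ∈ U, ∑ v ∈ U ∩ nbr G u, (((#(U ∩ nbr G v) : ℝ) - 1) * B (#(U ∩ nbr G u) - 1) +
        #(U ∩ nbr G u ∩ nbr G v) * (B (#(U ∩ nbr G u) - 2) - B (#(U ∩ nbr G u) - 1))) :=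
        sum_congr rfl fun u hu => sum_congr rfl fun v hv => inner u hu v hv
    _ = _ := by
        rw [energy_eq, ← sum_add_distrib]
        refine sum_congr rfl fun u _ => ?_
        have : (#(U ∩ nbr G u) : ℝ) * ((#(U ∩ nbr G u) : ℝ) - 1) * B (#(U ∩ nbr G u) - 1) =
            ∑ v ∈ U ∩ nbr G u, ((#(U ∩ nbr G u) : ℝ) - 1) * B (#(U ∩ nbr G u) - 1) := by
          rw [sum_const, nsmul_eq_mul]; ring
        rw [this, ← sum_add_distrib]
        refine sum_congr rfl fun v _ => ?_
        ring

/-- The balance equation of the monomer-dimer model, tested against a function of the number of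
uncovered neighbours. -/
theorem stein_identity {d : ℕ} (hG : ∀ v, #(nbr G v) = d) (B : ℕ → ℝ) (lam : ℝ) :
    ∑ M ∈ matchFam G, lam ^ #M * ∑ u ∈ unc M,
        (((d : ℝ) - #(unc M ∩ nbr G u)) * B #(unc M ∩ nbr G u) -
          lam * (#(unc M ∩ nbr G u) * ((#(unc M ∩ nbr G u) : ℝ) - 1) *
            B (#(unc M ∩ nbr G u) - 1))) =
      lam * ∑ M ∈ matchFam G, lam ^ #M * energy G B (unc M) := by
  have h1 : ∑ M ∈ matchFam G, lam ^ #M * ∑ u ∈ unc M,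
        ((d : ℝ) - #(unc M ∩ nbr G u)) * B #(unc M ∩ nbr G u) =
      ∑ M ∈ matchFam G, ∑ p ∈ arcs M, lam ^ #M * ∑ u ∈ unc M ∩ nbr G p.1,
        B #(unc M ∩ nbr G u) := by
    refine sum_congr rfl fun M hM => ?_
    rw [← sum_covered hM (fun v => lam ^ #M * ∑ u ∈ unc M ∩ nbr G v, B #(unc M ∩ nbr G u)),
      ← mul_sum]
    congr 1
    -- Count adjacent pairs of a covered v and an uncovered u; an uncovered u has d − Y_u covered
    -- neighbours.
    have hc : ∑ v ∈ (unc M)ᶜ, ∑ u ∈ unc M ∩ nbr G v, B #(unc M ∩ nbr G u) =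
        ∑ u ∈ unc M, ∑ v ∈ nbr G u \ unc M, B #(unc M ∩ nbr G u) :=
      sum_comm' fun v u => by simp [G.adj_comm]; tauto
    rw [hc]
    refine sum_congr rfl fun u _ => ?_
    rw [sum_const, nsmul_eq_mul]
    congr 1
    have := card_sdiff_add_card_inter (nbr G u) (unc M)
    rw [hG, inter_comm] at this
    rw [← this]
    push_cast
    ring
  -- Removing the matching edge at v uncovers both its ends, so the pair (u, v) becomes a path u–v–w
  -- of uncovered vertices, at the price of a factor lam.
  rw [sum_arcs_exchange] at h1
  have h2 : ∑ M ∈ matchFam G, ∑ p ∈ arcsIn G (unc M), lam ^ #(insert s(p.1, p.2) M) *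
        ∑ u ∈ unc (insert s(p.1, p.2) M) ∩ nbr G p.1,
          B #(unc (insert s(p.1, p.2) M) ∩ nbr G u) =
      ∑ M ∈ matchFam G, lam ^ #M * (lam * (∑ u ∈ unc M, (#(unc M ∩ nbr G u) : ℝ) *
        ((#(unc M ∩ nbr G u) : ℝ) - 1) * B (#(unc M ∩ nbr G u) - 1) +
          energy G B (unc M))) := by
    refine sum_congr rfl fun M _ => ?_
    rw [← sum_path_eq, mul_sum, mul_sum]
    refine sum_congr rfl fun p hp => ?_
    rw [card_insert_of_notMem (notMem_of_mem_arcsIn_unc hp), unc_insert]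
    ring
  rw [h2] at h1
  simp only [sum_sub_distrib, ← mul_sum, mul_sub (lam ^ _)]
  rw [h1, mul_sum, ← sum_sub_distrib]
  refine sum_congr rfl fun M _ => ?_
  ring

end Match

/-! ### The Stein equation -/

/-- The Stein equation for the number of uncovered neighbours of a vertex of `K_{d,d}`. -/
def SteinEq (d : ℕ) (lam mu : ℝ) (B : ℕ → ℝ) : Prop :=
  ∀ k : ℕ, k ≤ d → ((d : ℝ) - k) * B k - lam * (k * ((k : ℝ) - 1) * B (k - 1)) = mu - k

theorem SteinEq.diff {d : ℕ} {lam mu : ℝ} {B : ℕ → ℝ} (h : SteinEq d lam mu B) {k : ℕ}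
    (hk : k + 1 ≤ d) :
    ((d : ℝ) - k - 1) * (B (k + 1) - B k) =
      lam * (k * ((k : ℝ) - 1)) * (B k - B (k - 1)) + ((1 + 2 * lam * k) * B k - 1) := by
  have h1 := h k (by omega)
  have h2 := h (k + 1) hk
  simp only [Nat.add_sub_cancel] at h2
  push_cast at h2
  linear_combination h2 - h1

/-- By `SteinEq.diff`, a first failure of strict decrease at k forces (1 + 2 lam k) B k ≥ 1. From
there on monotonicity and this bound propagate upwards together, until they contradict the
difference equation at d − 1. -/
theorem SteinEq.lt {d : ℕ} {lam mu : ℝ} {B : ℕ → ℝ} (h : SteinEq d lam mu B) (hl : 0 < lam)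
    {k : ℕ} (hk : k + 1 < d) : B (k + 1) < B k := by
  induction k using Nat.strong_induction_on with
  | _ k ih =>
    by_contra hc
    rw [not_lt] at hc
    have hpos : ∀ j : ℕ, j + 1 < d → (0 : ℝ) < (d : ℝ) - j - 1 := fun j hj => by
      have : ((j + 1 : ℕ) : ℝ) < d := by exact_mod_cast hj
      push_cast at this; linarith
    have hcoef : ∀ j : ℕ, (0 : ℝ) ≤ lam * (j * ((j : ℝ) - 1)) := fun j => by
      refine mul_nonneg hl.le ?_
      rcases Nat.eq_zero_or_pos j with rfl | hj
      · simp
      · have : (1 : ℝ) ≤ j := by exact_mod_cast hj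
        exact mul_nonneg (by positivity) (by linarith)
    have hbase : 0 ≤ (1 + 2 * lam * k) * B k - 1 := by
      have h1 := h.diff hk.le
      have h2 : 0 ≤ ((d : ℝ) - k - 1) * (B (k + 1) - B k) :=
        mul_nonneg (hpos k hk).le (sub_nonneg.2 hc)
      have h3 : lam * (k * ((k : ℝ) - 1)) * (B k - B (k - 1)) ≤ 0 := by
        rcases Nat.eq_zero_or_pos k with rfl | hk0
        · simp
        · have := ih (k - 1) (by omega) (by omega)
          rw [Nat.sub_add_cancel hk0] at this
          exact mul_nonpos_of_nonneg_of_nonpos (hcoef k) (by linarith)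
      linarith
    have hstep : ∀ j : ℕ, B j ≤ B (j + 1) → 0 ≤ (1 + 2 * lam * j) * B j - 1 →
        0 < (1 + 2 * lam * (j + 1 : ℕ)) * B (j + 1) - 1 := by
      intro j h1 h2
      have hj : (0 : ℝ) ≤ 2 * lam * j := by positivity
      have hB : 0 < B j := by
        by_contra hn
        rw [not_lt] at hn
        nlinarith
      push_cast
      nlinarith
    have hall : ∀ j, k ≤ j → j + 1 < d → B j ≤ B (j + 1) ∧ 0 ≤ (1 + 2 * lam * j) * B j - 1 := by
      intro j hj
      induction j, hj using Nat.le_induction with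
      | base => exact fun _ => ⟨hc, hbase⟩
      | succ j hj ihj =>
        intro hjd
        obtain ⟨h1, h2⟩ := ihj (by omega)
        have h3 := hstep j h1 h2
        refine ⟨?_, h3.le⟩
        have h4 := h.diff hjd.le
        rw [Nat.add_sub_cancel] at h4
        have h5 := mul_nonneg (hcoef (j + 1)) (sub_nonneg.2 h1)
        have h6 : 0 < ((d : ℝ) - (j + 1 : ℕ) - 1) * (B (j + 1 + 1) - B (j + 1)) := by linarith
        exact (sub_pos.1 (pos_of_mul_pos_right h6 (hpos _ hjd).le)).le
    -- At index d − 1 = m + 1 the coefficient on the left of the difference equation is zero,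
    -- whereas the right side is positive.
    obtain ⟨m, rfl⟩ : ∃ m, d = m + 2 := ⟨d - 2, by omega⟩
    obtain ⟨h1, h2⟩ := hall m (by omega) (by omega)
    have h3 := hstep m h1 h2
    have h4 := h.diff (k := m + 1) (by omega)
    rw [Nat.add_sub_cancel] at h4
    have h5 := mul_nonneg (hcoef (m + 1)) (sub_nonneg.2 h1)
    have h6 : ((m + 2 : ℕ) : ℝ) - (m + 1 : ℕ) - 1 = 0 := by push_cast; ring
    rw [h6, zero_mul] at h4
    linarith

/-- The solution of the Stein equation by forward recursion. -/
def steinSol (d : ℕ) (lam mu : ℝ) : ℕ → ℝ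
  | 0 => mu / d
  | k + 1 => (mu - ((k : ℝ) + 1) + lam * (((k : ℝ) + 1) * k * steinSol d lam mu k)) /
      ((d : ℝ) - ((k : ℝ) + 1))

theorem steinSol_eq {d : ℕ} (lam mu : ℝ) {k : ℕ} (hk : k < d) :
    ((d : ℝ) - k) * steinSol d lam mu k -
      lam * (k * ((k : ℝ) - 1) * steinSol d lam mu (k - 1)) = mu - k := by
  have hkd : (d : ℝ) - k ≠ 0 := by
    have : (k : ℝ) < d := by exact_mod_cast hk
    exact (sub_pos.2 this).ne'
  rcases k with _ | k
  · simp only [Nat.cast_zero, sub_zero] at hkd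
    simp [steinSol, mul_div_cancel₀ _ hkd]
  · push_cast at hkd
    simp only [steinSol, Nat.cast_succ, Nat.add_sub_cancel]
    rw [mul_div_cancel₀ _ hkd]
    ring

theorem continuousOn_steinSol (d : ℕ) {mu : ℝ → ℝ} {s : Set ℝ} (hmu : ContinuousOn mu s) (k : ℕ) :
    ContinuousOn (fun x => steinSol d x (mu x) k) s := by
  induction k with
  | zero => exact hmu.div_const _
  | succ k ih =>
    simp only [steinSol]
    fun_prop

/-! ### Energy bounds -/

section Energy

variable {V : Type*} [Fintype V] {G : SimpleGraph V} {d : ℕ}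

theorem card_inter_nbr_le (hG : ∀ v, #(nbr G v) = d) (U : Finset V) (v : V) :
    #(U ∩ nbr G v) ≤ d := hG v ▸ card_le_card inter_subset_right

/-- For a solution of the Stein equation, the test sum in `stein_identity` collapses to mu times the
number of uncovered vertices minus the sum of their uncovered degrees. -/
theorem match_balance (hG : ∀ v, #(nbr G v) = d) {lam mu : ℝ} {B : ℕ → ℝ}
    (hB : SteinEq d lam mu B) :
    mu * (Fintype.card V * partFun (matchFam G) lam - 2 * (lam * partDeriv (matchFam G) lam)) -
        2 * partDeriv (matchFam G) lam =
      lam * ∑ M ∈ matchFam G, lam ^ #M * energy G B (unc M) := by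
  rw [← stein_identity hG, ← sum_card_unc, ← sum_degree_unc, mul_sum, ← sum_sub_distrib]
  refine sum_congr rfl fun M _ => ?_
  rw [sum_congr rfl fun u _ => hB _ (card_inter_nbr_le hG (unc M) u), sum_sub_distrib, sum_const,
    nsmul_eq_mul]
  ring

/-- An edge with ends of different degrees, or in a triangle, in the graph induced on `U`. -/
def IsDefect (G : SimpleGraph V) (U : Finset V) (u v : V) : Prop :=
  #(U ∩ nbr G u) ≠ #(U ∩ nbr G v) ∨ (U ∩ nbr G u ∩ nbr G v).Nonempty

/-- Since `B` drops by at least `g` at each step below `d`, both summands of the energy are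
nonnegative; unequal degrees make the first at least g/2, and a triangle makes the second at least
g. -/
theorem edgeEnergy_ge (hG : ∀ v, #(nbr G v) = d) {B : ℕ → ℝ} {g : ℝ} (hg : 0 ≤ g)
    (hB : ∀ k, k + 1 < d → g ≤ B k - B (k + 1)) {U : Finset V} {u v : V} (hu : u ∈ U)
    (hv : v ∈ U ∩ nbr G u) :
    (if IsDefect G U u v then 1 / 2 * g else 0) ≤ edgeEnergy G B U u v := by
  have hanti : ∀ i j, i ≤ j → j < d → B j ≤ B i := by
    intro i j hij
    induction j, hij using Nat.le_induction with
    | base => exact fun _ => le_rfl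
    | succ j hj ih =>
      intro hjd
      have := hB j hjd
      have := ih (by omega)
      linarith
  have hgap : ∀ i j, i < j → j < d → g ≤ B i - B j := by
    intro i j hij hjd
    have h1 := hB i (by omega)
    have h2 := hanti (i + 1) j hij hjd
    linarith
  obtain ⟨hvU, huv⟩ := mem_inter.1 hv
  rw [mem_nbr] at huv
  have hYu : 0 < #(U ∩ nbr G u) := card_pos.2 ⟨v, hv⟩
  have hYv : 0 < #(U ∩ nbr G v) := card_pos.2 ⟨u, by simp [hu, huv.symm]⟩
  have hYud := card_inter_nbr_le hG U u
  have hYvd := card_inter_nbr_le hG U v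
  have hτ : #(U ∩ nbr G u ∩ nbr G v) + 1 ≤ #(U ∩ nbr G u) := by
    rw [← card_insert_of_notMem (s := U ∩ nbr G u ∩ nbr G v) (a := v) (by simp)]
    exact card_le_card (insert_subset hv inter_subset_left)
  unfold edgeEnergy IsDefect
  rw [← card_pos]
  set a := #(U ∩ nbr G u)
  set b := #(U ∩ nbr G v)
  set t := #(U ∩ nbr G u ∩ nbr G v)
  have hdeg : ∀ m n : ℕ, 0 < m → m < n → n ≤ d → g ≤ ((n : ℝ) - m) * (B (m - 1) - B (n - 1)) := by
    intro m n hm hmn hnd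
    have h1 : (1 : ℝ) ≤ (n : ℝ) - m := by
      have : ((m + 1 : ℕ) : ℝ) ≤ n := by exact_mod_cast hmn
      push_cast at this; linarith
    have h2 := hgap (m - 1) (n - 1) (by omega) (by omega)
    nlinarith
  have h1 : (if a ≠ b then g else 0) ≤ ((b : ℝ) - a) * (B (a - 1) - B (b - 1)) := by
    split_ifs with hab
    · rcases lt_or_gt_of_ne hab with h | h
      · exact hdeg a b hYu h hYvd
      · have := hdeg b a hYv h hYud
        linarith
    · rw [not_not] at hab
      simp [hab]
  have h2 : (if 0 < t then g else 0) ≤ (t : ℝ) * (B (a - 2) - B (a - 1)) := by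
    split_ifs with ht
    · have h3 : (1 : ℝ) ≤ t := by exact_mod_cast ht
      -- A common neighbour forces a ≥ 2, so the subtractions are not truncated.
      have h4 := hgap (a - 2) (a - 1) (by omega) (by omega)
      nlinarith
    · have : t = 0 := by omega
      simp [this]
  by_cases hab : a ≠ b
  · rw [if_pos hab] at h1
    rw [if_pos (Or.inl hab)]
    have : (0 : ℝ) ≤ if 0 < t then g else 0 := by split_ifs <;> linarith
    linarith
  · rw [if_neg hab] at h1
    by_cases ht : 0 < t
    · rw [if_pos ht] at h2
      rw [if_pos (Or.inr ht)]
      linarith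
    · rw [if_neg ht] at h2
      rw [if_neg (by tauto)]
      linarith

theorem energy_ge (hG : ∀ v, #(nbr G v) = d) {B : ℕ → ℝ} {g : ℝ} (hg : 0 ≤ g)
    (hB : ∀ k, k + 1 < d → g ≤ B k - B (k + 1)) (U : Finset V) :
    ∑ v, (if v ∈ U ∧ ∃ u ∈ U ∩ nbr G v, IsDefect G U v u then 1 / 2 * g else 0) ≤
      energy G B U := by
  have h0 : ∀ u ∈ U, ∀ v ∈ U ∩ nbr G u, 0 ≤ edgeEnergy G B U u v := fun u hu v hv =>
    le_trans (by split_ifs <;> linarith) (edgeEnergy_ge hG hg hB hu hv)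
  rw [energy, ← sum_subset (subset_univ U) (fun v _ hv => by simp [hv])]
  refine sum_le_sum fun v hv => ?_
  split_ifs with h
  · obtain ⟨-, u, hu, hdef⟩ := h
    have h1 := edgeEnergy_ge hG hg hB hv hu
    rw [if_pos hdef] at h1
    exact h1.trans (single_le_sum (fun w hw => h0 v hv w hw) hu)
  · exact sum_nonneg fun w hw => h0 v hv w hw

/-- The weight of the matchings that leave a defect at `v`. -/
def matchDefect (G : SimpleGraph V) (v : V) (lam : ℝ) : ℝ :=
  ∑ M ∈ matchFam G with v ∈ unc M ∧ ∃ u ∈ unc M ∩ nbr G v, IsDefect G (unc M) v u, lam ^ #M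

theorem matchDefect_nonneg (G : SimpleGraph V) (v : V) {lam : ℝ} (hl : 0 ≤ lam) :
    0 ≤ matchDefect G v lam := sum_nonneg fun _ _ => by positivity

theorem sum_energy_ge (hG : ∀ v, #(nbr G v) = d) {B : ℕ → ℝ} {g lam : ℝ} (hg : 0 ≤ g)
    (hB : ∀ k, k + 1 < d → g ≤ B k - B (k + 1)) (hl : 0 ≤ lam) :
    1 / 2 * g * ∑ v, matchDefect G v lam ≤
      ∑ M ∈ matchFam G, lam ^ #M * energy G B (unc M) := by
  unfold matchDefect
  simp only [sum_filter]
  rw [sum_comm, mul_sum]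
  refine sum_le_sum fun M _ => ?_
  refine le_trans (le_of_eq ?_) (mul_le_mul_of_nonneg_left (energy_ge hG hg hB (unc M))
    (by positivity : 0 ≤ lam ^ #M))
  rw [mul_sum, mul_sum]
  refine sum_congr rfl fun v _ => ?_
  split_ifs <;> ring

/-! ### Forcing defects at bad vertices -/

/-- The edges that meet a set of vertices. -/
def incident (G : SimpleGraph V) (S : Finset V) : Finset (Sym2 V) :=
  {e | e ∈ G.edgeSet ∧ ∃ x ∈ S, x ∈ e}

theorem mem_incident {S : Finset V} {e : Sym2 V} :
    e ∈ incident G S ↔ e ∈ G.edgeSet ∧ ∃ x ∈ S, x ∈ e := by simp [incident]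

theorem card_incident_le (hG : ∀ v, #(nbr G v) = d) (S : Finset V) :
    #(incident G S) ≤ #S * d := by
  have hsub : incident G S ⊆ S.biUnion fun x => (nbr G x).image fun y => s(x, y) := by
    intro e he
    obtain ⟨h1, x, hx, hxe⟩ := mem_incident.1 he
    obtain ⟨y, rfl⟩ := hxe
    exact mem_biUnion.2 ⟨x, hx, mem_image.2 ⟨y, by simpa using h1, rfl⟩⟩
  exact (card_le_card hsub).trans
    (card_biUnion_le_card_mul _ _ _ fun x _ => card_image_le.trans (hG x).le)

theorem sdiff_union_mem_matchFam {T : Finset (Sym2 V)} {S : Finset V} (hT : T ∈ matchFam G)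
    (hTS : ∀ e ∈ T, ∀ x ∈ e, x ∈ S) {M : Finset (Sym2 V)} (hM : M ∈ matchFam G) :
    (M \ incident G S) ∪ T ∈ matchFam G := by
  rw [mem_matchFam] at *
  have key : ∀ e ∈ T, ∀ f ∈ M \ incident G S, ∀ v, v ∈ e → v ∉ f := by
    intro e he f hf v hve hvf
    obtain ⟨h1, h2⟩ := mem_sdiff.1 hf
    exact h2 (mem_incident.2 ⟨hM.1 f h1, v, hTS e he v hve, hvf⟩)
  constructor
  · intro e he
    rcases mem_union.1 he with he | he
    · exact hM.1 e (mem_sdiff.1 he).1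
    · exact hT.1 e he
  · intro e he f hf v hve hvf
    rcases mem_union.1 he with he | he <;> rcases mem_union.1 hf with hf | hf
    · exact hM.2 e (mem_sdiff.1 he).1 f (mem_sdiff.1 hf).1 v hve hvf
    · exact absurd hve (key f hf e he v hvf)
    · exact absurd hvf (key e he f hf v hve)
    · exact hT.2 e he f hf v hve hvf

/-- It suffices to prescribe the matching on the edges meeting at most d + 3 vertices, using at most
one edge. That window has at most (d + 3) d edges, and the extra 1 in the exponent absorbs the
weight of the pattern. -/
theorem matchDefect_ge (hG : ∀ v, #(nbr G v) = d) {v : V} (hv : ¬ IsGood G v) {lam : ℝ}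
    (hl : 0 ≤ lam) :
    lam * partFun (matchFam G) lam ≤ (1 + lam) ^ ((d + 3) * d + 1) * matchDefect G v lam := by
  have main : ∀ (T : Finset (Sym2 V)) (S : Finset V), T ∈ matchFam G →
      (∀ e ∈ T, ∀ x ∈ e, x ∈ S) → #T ≤ 1 → #S ≤ d + 3 →
      (∀ M ∈ matchFam G, (∀ x ∈ S, (∀ e ∈ T, x ∉ e) → x ∈ unc M) → T ⊆ M →
        v ∈ unc M ∧ ∃ u ∈ unc M ∩ nbr G v, IsDefect G (unc M) v u) →
      lam * partFun (matchFam G) lam ≤ (1 + lam) ^ ((d + 3) * d + 1) * matchDefect G v lam := by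
    intro T S hT hTS hT1 hS hdef
    have hTW : T ⊆ incident G S := fun e he => by
      refine mem_incident.2 ⟨(mem_matchFam.1 hT).1 e he, ?_⟩
      have : e.out.1 ∈ e := Sym2.out_fst_mem e
      exact ⟨_, hTS e he _ this, this⟩
    have h1 := pow_mul_partFun_le_window (F := matchFam G) hTW
      (fun M hM => sdiff_union_mem_matchFam hT hTS hM) hl
    have hZ := partFun_pos (empty_mem_matchFam G) hl
    have h2 : ∑ M ∈ matchFam G with M ∩ incident G S = T, lam ^ #M ≤ matchDefect G v lam := by
      refine sum_le_sum_of_subset_of_nonneg ?_ fun _ _ _ => by positivity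
      intro M hM
      obtain ⟨hM, hMW⟩ := mem_filter.1 hM
      refine mem_filter.2 ⟨hM, hdef M hM ?_ (by rw [← hMW]; exact inter_subset_left)⟩
      intro x hx hxT
      refine mem_unc.2 fun e he hxe => hxT e ?_ hxe
      rw [← hMW]
      exact mem_inter.2 ⟨he, mem_incident.2 ⟨(mem_matchFam.1 hM).1 e he, x, hx, hxe⟩⟩
    have h3 : lam ≤ (1 + lam) * lam ^ #T := by
      obtain h | h : #T = 0 ∨ #T = 1 := by omega
      · rw [h]; simp
      · rw [h]; nlinarith [mul_nonneg hl hl]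
    have hW : #(incident G S) ≤ (d + 3) * d :=
      (card_incident_le hG S).trans (Nat.mul_le_mul_right d hS)
    calc lam * partFun (matchFam G) lam
        ≤ (1 + lam) * lam ^ #T * partFun (matchFam G) lam := by gcongr
      _ = (1 + lam) * (lam ^ #T * partFun (matchFam G) lam) := by ring
      _ ≤ (1 + lam) * ((1 + lam) ^ #(incident G S) * matchDefect G v lam) := by
          refine mul_le_mul_of_nonneg_left (h1.trans ?_) (by positivity)
          gcongr
      _ = (1 + lam) ^ (#(incident G S) + 1) * matchDefect G v lam := by ring
      _ ≤ _ := by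
          refine mul_le_mul_of_nonneg_right ?_ (matchDefect_nonneg G v hl)
          exact pow_le_pow_right₀ (by linarith) (by omega)
  by_cases hind : ∀ u w, G.Adj v u → G.Adj v w → ¬ G.Adj u w
  · have h2 : ¬ ∀ u x, G.Adj v u → G.Adj u x → ∀ y, G.Adj v y → G.Adj x y :=
      fun h => hv ⟨hind, h⟩
    push Not at h2
    obtain ⟨u, x, hvu, hux, y, hvy, hxy⟩ := h2
    have hxv : ¬ G.Adj v x := fun h => hind u x hvu h hux
    -- By regularity, N(x) ≠ N(v) yields a neighbour z of x outside N(v). Matching x to z while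
    -- leaving v and N(v) uncovered gives v uncovered degree d, but u less than d.
    obtain ⟨z, hxz, hvz⟩ : ∃ z, G.Adj x z ∧ ¬ G.Adj v z := by
      by_contra hc
      push Not at hc
      have : nbr G x = nbr G v := nbr_eq_of_subset hG fun z hz => by
        simpa using hc z (by simpa using hz)
      exact hxy (by rw [← mem_nbr, this, mem_nbr]; exact hvy)
    have hvx : v ≠ x := fun h => hxy (h ▸ hvy)
    have hzv : v ≠ z := fun h => hxv (h ▸ hxz.symm)
    have hT : ({s(x, z)} : Finset (Sym2 V)) ∈ matchFam G := by
      rw [mem_matchFam]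
      simp only [IsMatchingSet, mem_singleton, forall_eq]
      exact ⟨hxz, fun _ _ _ => trivial⟩
    refine main {s(x, z)} (insert v (insert x (insert z (nbr G v)))) hT ?_ (by simp) ?_ ?_
    · intro e he a ha
      rw [mem_singleton] at he
      subst he
      rcases Sym2.mem_iff.1 ha with rfl | rfl <;> simp
    · have c1 := card_insert_le v (insert x (insert z (nbr G v)))
      have c2 := card_insert_le x (insert z (nbr G v))
      have c3 := card_insert_le z (nbr G v)
      rw [hG] at c3
      omega
    · intro M hM hun hTM
      have hvU : v ∈ unc M := hun v (by simp) (by simp [hvx, hzv])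
      have hNU : nbr G v ⊆ unc M := fun a ha => by
        rw [mem_nbr] at ha
        have hax : a ≠ x := fun h => hxv (h ▸ ha)
        have haz : a ≠ z := fun h => hvz (h ▸ ha)
        exact hun a (by simp [ha]) (by simp [hax, haz])
      have hxU : x ∉ unc M := fun h =>
        mem_unc.1 h s(x, z) (hTM (by simp)) (Sym2.mem_mk_left _ _)
      refine ⟨hvU, u, mem_inter.2 ⟨hNU (by simpa using hvu), by simpa using hvu⟩, Or.inl ?_⟩
      rw [inter_eq_right.2 hNU, hG]
      have : unc M ∩ nbr G u ⊂ nbr G u := by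
        refine ssubset_of_subset_of_ne inter_subset_right fun h => hxU ?_
        have hx : x ∈ nbr G u := by simpa using hux
        rw [← h] at hx
        exact (mem_inter.1 hx).1
      have := card_lt_card this
      rw [hG] at this
      omega
  · push Not at hind
    obtain ⟨u, w, hvu, hvw, huw⟩ := hind
    -- Leaving a triangle through `v` uncovered is already a defect.
    refine main ∅ {v, u, w} (empty_mem_matchFam G) (by simp) (by simp) ?_ ?_
    · exact card_le_three.trans (by omega)
    · intro M hM hun _
      have hU : ∀ x ∈ ({v, u, w} : Finset V), x ∈ unc M := fun x hx => hun x hx (by simp)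
      refine ⟨hU v (by simp), u, mem_inter.2 ⟨hU u (by simp), by simpa using hvu⟩, Or.inr ⟨w, ?_⟩⟩
      simp only [mem_inter, mem_nbr]
      exact ⟨⟨hU w (by simp), hvw⟩, huw⟩

end Energy

/-! ### Matchings of the complete bipartite graph -/

section Bipartite

variable {V : Type*} [Fintype V] {G : SimpleGraph V}

/-- Every matching edge uses one vertex of each colour class, so the uncovered parts of the two
equal classes have equal size. -/
theorem card_unc_inter_nbr_eq {c : V → Bool} (hc : ∀ u v, G.Adj u v ↔ c u ≠ c v)
    (hbal : ∑ v, (if c v then 1 else -1 : ℝ) = 0) {M : Finset (Sym2 V)} (hM : M ∈ matchFam G)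
    {u v : V} (huv : G.Adj u v) : #(unc M ∩ nbr G u) = #(unc M ∩ nbr G v) := by
  let h : V → ℝ := fun v => if c v then 1 else -1
  have harc : ∑ p ∈ arcs M, h p.1 = 0 := by
    have hswap : ∑ p ∈ arcs M, h p.1 = ∑ p ∈ arcs M, h p.2 := by
      refine sum_nbij' Prod.swap Prod.swap ?_ ?_ ?_ ?_ ?_
      · intro p hp; rw [mem_arcs] at *; rwa [Prod.fst_swap, Prod.snd_swap, Sym2.eq_swap]
      · intro p hp; rw [mem_arcs] at *; rwa [Prod.fst_swap, Prod.snd_swap, Sym2.eq_swap]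
      · intro p _; simp
      · intro p _; simp
      · intro p _; simp
    have hneg : ∑ p ∈ arcs M, h p.2 = ∑ p ∈ arcs M, -h p.1 := by
      refine sum_congr rfl fun p hp => ?_
      have := (mem_matchFam.1 hM).1 _ (mem_arcs.1 hp)
      rw [SimpleGraph.mem_edgeSet, hc] at this
      simp only [h]
      cases h1 : c p.1 <;> cases h2 : c p.2 <;> simp_all
    rw [sum_neg_distrib] at hneg
    linarith
  have hU : ∑ v ∈ unc M, h v = 0 := by
    have h1 := sum_covered hM h
    have h2 := sum_add_sum_compl (unc M) h
    have h3 : ∑ v, h v = 0 := hbal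
    linarith
  have hsplit : ∑ v ∈ unc M, h v =
      (#{x ∈ unc M | c x = true} : ℝ) - #{x ∈ unc M | c x = false} := by
    rw [card_filter, card_filter]
    push_cast
    rw [← sum_sub_distrib]
    refine sum_congr rfl fun x _ => ?_
    cases hx : c x <;> simp [h, hx]
  have hN : ∀ u, unc M ∩ nbr G u = {x ∈ unc M | c x = !c u} := fun u => by
    ext x
    simp only [mem_inter, mem_nbr, hc, mem_filter]
    cases c u <;> cases c x <;> simp
  have hcard : #{x ∈ unc M | c x = true} = #{x ∈ unc M | c x = false} := by
    rw [hsplit] at hU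
    exact_mod_cast sub_eq_zero.1 hU
  rw [hc] at huv
  rw [hN, hN]
  cases h1 : c u <;> cases h2 : c v <;> simp_all

theorem energy_eq_zero_of_bipartite {c : V → Bool} (hc : ∀ u v, G.Adj u v ↔ c u ≠ c v)
    (hbal : ∑ v, (if c v then 1 else -1 : ℝ) = 0) {M : Finset (Sym2 V)} (hM : M ∈ matchFam G)
    (B : ℕ → ℝ) : energy G B (unc M) = 0 := by
  refine sum_eq_zero fun u _ => sum_eq_zero fun v hv => ?_
  have huv := mem_nbr.1 (mem_inter.1 hv).2
  have hτ : unc M ∩ nbr G u ∩ nbr G v = ∅ := by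
    refine eq_empty_of_forall_notMem fun x hx => ?_
    simp only [mem_inter, mem_nbr, hc] at hx huv
    cases h1 : c u <;> cases h2 : c v <;> cases h3 : c x <;> simp_all
  rw [edgeEnergy, card_unc_inter_nbr_eq hc hbal hM huv, hτ]
  simp

/-- If the energies of a regular graph vanish, then the forward recursion also solves the last
equation of the Stein system. -/
theorem steinEq_of_energy_eq_zero [Nonempty V] {d : ℕ} (hG : ∀ v, #(nbr G v) = d)
    (hE : ∀ M ∈ matchFam G, ∀ B, energy G B (unc M) = 0) {lam mu : ℝ} (hl : 0 ≤ lam)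
    (hmu : mu * (Fintype.card V * partFun (matchFam G) lam -
      2 * (lam * partDeriv (matchFam G) lam)) = 2 * partDeriv (matchFam G) lam) :
    SteinEq d lam mu (steinSol d lam mu) := by
  set B := steinSol d lam mu with hB
  -- The residual of the equation at k = d. There the recursion divides by 0 and returns the default
  -- value 0, which is harmless because `B d` has coefficient 0.
  set R : ℝ := ((d : ℝ) - d) * B d - lam * (d * ((d : ℝ) - 1) * B (d - 1)) - (mu - d) with hR
  have hterm : ∀ k ≤ d, ((d : ℝ) - k) * B k - lam * (k * ((k : ℝ) - 1) * B (k - 1)) =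
      mu - k + if k = d then R else 0 := by
    intro k hk
    rcases hk.lt_or_eq with h | h
    · rw [hB, steinSol_eq lam _ h, if_neg h.ne, add_zero]
    · rw [h, if_pos rfl, hR]; ring
  have hst := stein_identity hG B lam
  have hzero : ∑ M ∈ matchFam G, lam ^ #M * energy G B (unc M) = 0 :=
    sum_eq_zero fun M hM => by rw [hE M hM, mul_zero]
  rw [hzero, mul_zero] at hst
  have hmean : ∑ M ∈ matchFam G, lam ^ #M * ∑ u ∈ unc M, (mu - #(unc M ∩ nbr G u)) = 0 := by
    rw [← sum_card_unc G lam, ← sum_degree_unc G lam, mul_sum, ← sub_eq_zero,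
      ← sum_sub_distrib] at hmu
    rw [← hmu]
    refine sum_congr rfl fun M _ => ?_
    rw [sum_sub_distrib, sum_const, nsmul_eq_mul]
    ring
  have hsum : R * ∑ M ∈ matchFam G, lam ^ #M * (#{u ∈ unc M | #(unc M ∩ nbr G u) = d} : ℝ) = 0 := by
    rw [← hst, ← add_zero (R * _), ← hmean, mul_sum, ← sum_add_distrib]
    refine sum_congr rfl fun M _ => ?_
    rw [sum_congr rfl fun u _ => hterm _ (card_inter_nbr_le hG (unc M) u), sum_add_distrib,
      ← sum_filter, sum_const, nsmul_eq_mul]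
    ring
  have hpos : 0 < ∑ M ∈ matchFam G, lam ^ #M *
      (#{u ∈ unc M | #(unc M ∩ nbr G u) = d} : ℝ) := by
    -- The empty matching leaves every vertex with d uncovered neighbours, so the factor multiplying
    -- the residual is positive.
    refine sum_pos' (fun M _ => by positivity) ⟨∅, empty_mem_matchFam _, ?_⟩
    have : unc (∅ : Finset (Sym2 V)) = univ := by ext; simp [mem_unc]
    simp only [this, univ_inter, hG, card_empty, pow_zero, one_mul, Nat.cast_pos]
    exact card_pos.2 ⟨Classical.arbitrary V, by simp⟩
  have hR0 : R = 0 := (mul_eq_zero.1 hsum).resolve_right hpos.ne'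
  intro k hk
  rw [hterm k hk, hR0, ite_self, add_zero]

end Bipartite

/-! ### Constants determined by K_{d,d} and the matching rate -/

section Kdd

variable (d : ℕ)

/-- The mean number of uncovered neighbours of an uncovered vertex of `K_{d,d}`. -/
def meanUnc (lam : ℝ) : ℝ :=
  2 * partDeriv (matchFam (completeBipartiteGraph (Fin d) (Fin d))) lam /
    (2 * d * partFun (matchFam (completeBipartiteGraph (Fin d) (Fin d))) lam -
      2 * (lam * partDeriv (matchFam (completeBipartiteGraph (Fin d) (Fin d))) lam))

variable {d}

theorem meanUnc_denom_pos (hd : 0 < d) {lam : ℝ} (hl : 0 ≤ lam) :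
    0 < 2 * d * partFun (matchFam (completeBipartiteGraph (Fin d) (Fin d))) lam -
      2 * (lam * partDeriv (matchFam (completeBipartiteGraph (Fin d) (Fin d))) lam) := by
  have h := sum_card_unc (completeBipartiteGraph (Fin d) (Fin d)) lam
  have hc : (Fintype.card (Fin d ⊕ Fin d) : ℝ) = 2 * d := by simp; ring
  rw [hc] at h
  rw [← h]
  refine sum_pos' (fun M _ => by positivity) ⟨∅, empty_mem_matchFam _, ?_⟩
  have : unc (∅ : Finset (Sym2 (Fin d ⊕ Fin d))) = univ := by ext; simp [mem_unc]
  rw [this, card_univ, hc]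
  simpa using hd

theorem meanUnc_nonneg (hd : 0 < d) {lam : ℝ} (hl : 0 ≤ lam) : 0 ≤ meanUnc d lam :=
  div_nonneg (mul_nonneg zero_le_two (partDeriv_nonneg _ hl)) (meanUnc_denom_pos hd hl).le

theorem continuousOn_meanUnc (hd : 0 < d) : ContinuousOn (meanUnc d) (Set.Ici 0) := by
  have h1 := continuous_partFun (matchFam (completeBipartiteGraph (Fin d) (Fin d)))
  have h2 := continuous_partDeriv (matchFam (completeBipartiteGraph (Fin d) (Fin d)))
  refine ContinuousOn.div (by fun_prop) (by fun_prop) fun x hx => ?_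
  exact (meanUnc_denom_pos hd hx).ne'

theorem steinEq_steinSol (hd : 0 < d) {lam : ℝ} (hl : 0 ≤ lam) :
    SteinEq d lam (meanUnc d lam) (steinSol d lam (meanUnc d lam)) := by
  have : Nonempty (Fin d ⊕ Fin d) := ⟨Sum.inl ⟨0, hd⟩⟩
  refine steinEq_of_energy_eq_zero (card_nbr_completeBipartiteGraph d) (fun M hM B =>
    energy_eq_zero_of_bipartite (c := Sum.isLeft) ?_ (by simp) hM B) hl ?_
  · rintro (u | u) (v | v) <;> simp
  · have hc : (Fintype.card (Fin d ⊕ Fin d) : ℝ) = 2 * d := by simp; ring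
    rw [hc]
    exact div_mul_cancel₀ _ (meanUnc_denom_pos hd hl).ne'

/-- The least decrement of the solution of the Stein equation. -/
def steinGap (hd : 2 ≤ d) (lam : ℝ) : ℝ :=
  (range (d - 1)).inf' (nonempty_range_iff.2 (by omega)) fun k =>
    steinSol d lam (meanUnc d lam) k - steinSol d lam (meanUnc d lam) (k + 1)

theorem continuousOn_steinGap (hd : 2 ≤ d) : ContinuousOn (steinGap hd) (Set.Ici 0) := by
  refine ContinuousOn.finset_inf'_apply _ fun k _ => ?_
  have := continuousOn_meanUnc (d := d) (by omega)
  exact (continuousOn_steinSol d this k).sub (continuousOn_steinSol d this (k + 1))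

theorem steinGap_le (hd : 2 ≤ d) (lam : ℝ) {k : ℕ} (hk : k + 1 < d) :
    steinGap hd lam ≤
      steinSol d lam (meanUnc d lam) k - steinSol d lam (meanUnc d lam) (k + 1) :=
  inf'_le (fun k => steinSol d lam (meanUnc d lam) k - steinSol d lam (meanUnc d lam) (k + 1))
    (mem_range.2 (by omega))

theorem steinGap_pos (hd : 2 ≤ d) {lam : ℝ} (hl : 0 < lam) : 0 < steinGap hd lam := by
  rw [steinGap, lt_inf'_iff]
  intro k hk
  have := mem_range.1 hk
  exact sub_pos.2 ((steinEq_steinSol (by omega) hl.le).lt hl (by omega))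

/-- The rate of the stability bound for matchings. -/
def matchRate (hd : 2 ≤ d) (lam : ℝ) : ℝ :=
  lam ^ 2 * steinGap hd lam / (4 * (1 + lam * meanUnc d lam) * (1 + lam) ^ ((d + 3) * d + 1))

theorem continuousOn_matchRate (hd : 2 ≤ d) : ContinuousOn (matchRate hd) (Set.Ici 0) := by
  have h1 := continuousOn_steinGap hd
  have h2 := continuousOn_meanUnc (d := d) (by omega)
  refine ContinuousOn.div (by fun_prop) (by fun_prop) fun x hx => ?_
  have hx : (0 : ℝ) ≤ x := hx
  have := meanUnc_nonneg (d := d) (by omega) hx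
  positivity

theorem matchRate_pos (hd : 2 ≤ d) {lam : ℝ} (hl : 0 < lam) : 0 < matchRate hd lam := by
  have h1 := steinGap_pos hd hl
  have h2 := meanUnc_nonneg (d := d) (by omega) hl.le
  unfold matchRate
  positivity

theorem match_deriv_le {V : Type*} [Fintype V] [Nonempty V] {G : SimpleGraph V} (hd : 2 ≤ d)
    (hG : ∀ v, #(nbr G v) = d) {lam : ℝ} (hl : 0 < lam) :
    1 / (Fintype.card V : ℝ) * (partDeriv (matchFam G) lam / partFun (matchFam G) lam) +
        matchRate hd lam * (#(bad G) / (Fintype.card V : ℝ)) ≤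
      1 / (2 * (d : ℝ)) * (partDeriv (matchFam (completeBipartiteGraph (Fin d) (Fin d))) lam /
        partFun (matchFam (completeBipartiteGraph (Fin d) (Fin d))) lam) := by
  have hd0 : 0 < d := by omega
  have hd0' : (0 : ℝ) < d := by exact_mod_cast hd0
  have hn : (0 : ℝ) < Fintype.card V := by exact_mod_cast Fintype.card_pos
  have hZ := partFun_pos (empty_mem_matchFam G) hl.le
  have hZK := partFun_pos (empty_mem_matchFam (completeBipartiteGraph (Fin d) (Fin d))) hl.le
  have hmu := meanUnc_nonneg hd0 hl.le
  have hgap := steinGap_pos hd hl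
  have hbal := match_balance hG (steinEq_steinSol hd0 hl.le)
  have hK : meanUnc d lam *
      (2 * d * partFun (matchFam (completeBipartiteGraph (Fin d) (Fin d))) lam -
        2 * (lam * partDeriv (matchFam (completeBipartiteGraph (Fin d) (Fin d))) lam)) =
      2 * partDeriv (matchFam (completeBipartiteGraph (Fin d) (Fin d))) lam :=
    div_mul_cancel₀ _ (meanUnc_denom_pos hd0 hl.le).ne'
  have hen := sum_energy_ge hG (B := steinSol d lam (meanUnc d lam)) hgap.le (fun k hk => steinGap_le hd lam hk) hl.le
  have hdef : #(bad G) * (lam * partFun (matchFam G) lam / (1 + lam) ^ ((d + 3) * d + 1)) ≤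
      ∑ v, matchDefect G v lam := by
    rw [← nsmul_eq_mul, ← sum_const]
    refine le_trans (sum_le_sum fun v hv => ?_)
      (sum_le_sum_of_subset_of_nonneg (subset_univ (bad G))
        fun v _ _ => matchDefect_nonneg G v hl.le)
    rw [div_le_iff₀ (by positivity), mul_comm (matchDefect G v lam)]
    exact matchDefect_ge hG (by simpa [bad] using hv) hl.le
  unfold matchRate
  set Z := partFun (matchFam G) lam
  set Z' := partDeriv (matchFam G) lam
  set W := partFun (matchFam (completeBipartiteGraph (Fin d) (Fin d))) lam
  set W' := partDeriv (matchFam (completeBipartiteGraph (Fin d) (Fin d))) lam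
  set mu := meanUnc d lam
  set g := steinGap hd lam
  set n : ℝ := (Fintype.card V : ℝ)
  set P := (1 + lam) ^ ((d + 3) * d + 1)
  have hP : 0 < P := by positivity
  have hden : 0 < 1 + lam * mu := by positivity
  have h1 : lam * (1 / 2 * g * (#(bad G) * (lam * Z / P))) ≤
      mu * (n * Z - 2 * (lam * Z')) - 2 * Z' := by
    rw [hbal]
    refine mul_le_mul_of_nonneg_left (le_trans ?_ hen) hl.le
    exact mul_le_mul_of_nonneg_left hdef (by positivity)
  -- Solving the definition of mu for the occupancy gives mu / (2 (1 + lam mu)); the same division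
  -- turns the energy bound into the rate.
  have e1 : 1 / (2 * (d : ℝ)) * (W' / W) = mu * (n * Z) / (2 * (1 + lam * mu) * (n * Z)) := by
    field_simp
    linarith
  have e2 : 1 / n * (Z' / Z) + lam ^ 2 * g / (4 * (1 + lam * mu) * P) * (#(bad G) / n) =
      (2 * (1 + lam * mu) * Z' + lam * (1 / 2 * g * (#(bad G) * (lam * Z / P)))) /
        (2 * (1 + lam * mu) * (n * Z)) := by
    field_simp
    ring
  rw [e1, e2]
  gcongr
  linarith

end Kdd

/-! ### Assembly: integration, then replacing the bad fraction by the sampling distance -/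

theorem stability_of_deriv {V α β : Type*} [Fintype V] [Nonempty V] {G : SimpleGraph V} {d : ℕ}
    (hd : 0 < d) (hG : ∀ v, #(nbr G v) = d) {F : Finset (Finset α)} {K : Finset (Finset β)}
    (hF : ∅ ∈ F) (hK : ∅ ∈ K) {s c : ℝ → ℝ} (hs : ContinuousOn s (Set.Ici 0)) (hs0 : s 0 = 0)
    (hsm : StrictMonoOn s (Set.Ici 0)) (hsd : ∀ x, 0 < x → HasDerivAt s (c x) x)
    (h : ∀ x, 0 < x → 1 / (Fintype.card V : ℝ) * (partDeriv F x / partFun F x) +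
      c x * (#(bad G) / (Fintype.card V : ℝ)) ≤
      1 / (2 * (d : ℝ)) * (partDeriv K x / partFun K x)) {x : ℝ} (hx : 0 ≤ x) :
    1 / (Fintype.card V : ℝ) * Real.log (partFun F x) ≤
      1 / (2 * (d : ℝ)) * Real.log (partFun K x) -
        s x * samplingDist G (completeBipartiteGraph (Fin d) (Fin d)) := by
  have h1 := log_partFun_le_of_deriv hF hK hs hs0 hsd h hx
  have hsx : 0 ≤ s x := hs0 ▸ hsm.monotoneOn Set.self_mem_Ici hx hx
  have h2 := mul_le_mul_of_nonneg_left (samplingDist_le hd hG) hsx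
  linarith

end

end RegularStability

theorem theorem4 (d : ℕ) (hd : 2 ≤ d) :
    ∃ sMatch sInd : ℝ → ℝ,
      ContinuousOn sMatch (Set.Ici 0) ∧ ContinuousOn sInd (Set.Ici 0) ∧
      sMatch 0 = 0 ∧ sInd 0 = 0 ∧
      StrictMonoOn sMatch (Set.Ici 0) ∧ StrictMonoOn sInd (Set.Ici 0) ∧
      ∀ (V : Type*) [Fintype V] [Nonempty V] (G : SimpleGraph V) [G.LocallyFinite],
        G.IsRegularOfDegree d →
        ∀ lam : ℝ, 0 ≤ lam →
          1 / (Fintype.card V : ℝ) * Real.log (RegularStability.Zmatch G lam) ≤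
            1 / (2 * (d : ℝ)) * Real.log
                (RegularStability.Zmatch (completeBipartiteGraph (Fin d) (Fin d)) lam)
              - sMatch lam *
                RegularStability.samplingDist G (completeBipartiteGraph (Fin d) (Fin d)) ∧
          1 / (Fintype.card V : ℝ) * Real.log (RegularStability.Zind G lam) ≤
            1 / (2 * (d : ℝ)) * Real.log
                (RegularStability.Zind (completeBipartiteGraph (Fin d) (Fin d)) lam)
              - sInd lam *
                RegularStability.samplingDist G (completeBipartiteGraph (Fin d) (Fin d)) := by
  have hd0 : 0 < d := by omega
  obtain ⟨s, hs, hs0, hsm, hsd⟩ := RegularStability.exists_strictMonoOn_primitive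
    (RegularStability.continuousOn_matchRate hd) fun x hx => RegularStability.matchRate_pos hd hx
  obtain ⟨t, ht, ht0, htm, htd⟩ := RegularStability.exists_strictMonoOn_primitive
    (RegularStability.continuousOn_indRate hd0) fun x hx => RegularStability.indRate_pos hd0 hx
  refine ⟨s, t, hs, ht, hs0, ht0, hsm, htm, ?_⟩
  intro V _ _ G _ hreg lam hlam
  have hG : ∀ v, (RegularStability.nbr G v).card = d := by
    intro v
    rw [← hreg v, ← SimpleGraph.card_neighborFinset_eq_degree]
    congr 1
    ext w
    simp
  rw [RegularStability.Zmatch_eq, RegularStability.Zmatch_eq, RegularStability.Zind_eq,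
    RegularStability.Zind_eq]
  exact ⟨RegularStability.stability_of_deriv hd0 hG (RegularStability.empty_mem_matchFam G)
      (RegularStability.empty_mem_matchFam _) hs hs0 hsm hsd
      (fun x hx => RegularStability.match_deriv_le hd hG hx) hlam,
    RegularStability.stability_of_deriv hd0 hG (RegularStability.empty_mem_indFam G)
      (RegularStability.empty_mem_indFam _) ht ht0 htm htd
      (fun x hx => RegularStability.ind_deriv_le hd hG hx) hlam⟩
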